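/- Let $n\ge 0$. For a partition $R\vdash n$ let $V_R$ be the irreducible representation (Specht module) of $S_n$ labelled by $R$, $d(R)$ its dimension, $\chi^R$ its character, and let $$\mathsf C(R_1,R_2,R_3)=\frac1{n!}\sum_{\sigma\in S_n}\chi^{R_1}(\sigma)\chi^{R_2}(\sigma)\chi^{R_3}(\sigma)$$ be the Kronecker coefficient. Let $z_R=\sum_{\sigma}\chi^R(\sigma)\,\sigma\in\mathbb C(S_n)$, and let $\boldsymbol\delta_d$ be the bilinear pairing on $\mathbb C(S_n)^{\otimes d}$ with $\boldsymbol\delta_d(\otimes_i\sigma_i;\otimes_i\sigma_i')=\prod_i\delta(\sigma_i\sigma_i'^{-1})$. There are bases of the $V_R$ in which $S_n$ acts by real orthogonal matrices $D^R(\sigma)$, and for each choice of such bases there are real Clebsch–Gordan coefficients $C^{R_1,R_2;R_3,\tau}_{i_1,i_2;i_3}$, i.e. orthogonal changes of basis from the product bases of $V_{R_1}\otimes V_{R_2}$ to bases $|R_3,\tau,i_3\rangle$ ($\tau$ numbering the copies of $V_{R_3}$) on which $S_n$ acts through the $D^{R_3}$. For any such choices put $$P^{R_1,R_2,R_3}=\frac{d(R_1)d(R_2)}{(n!)^2}\sum_{\tau}\sum_{\sigma_1,\sigma_2}\sum_{i_l,j_l}C^{R_1,R_2;R_3,\tau}_{i_1,i_2;i_3}C^{R_1,R_2;R_3,\tau}_{j_1,j_2;i_3}D^{R_1}_{i_1j_1}(\sigma_1)D^{R_2}_{i_2j_2}(\sigma_2)\,\sigma_1\otimes\sigma_2,$$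 $$P_{\rm un}^{R_1,R_2,R_3}=\frac{d(R_1)d(R_2)d(R_3)}{(n!)^3}\sum_{\tau}\sum_{\sigma_1,\sigma_2,\sigma_3}\sum_{i_l,j_l}C^{R_1,R_2;R_3,\tau}_{i_1,i_2;i_3}C^{R_1,R_2;R_3,\tau}_{j_1,j_2;j_3}D^{R_1}_{i_1j_1}(\sigma_1)D^{R_2}_{i_2j_2}(\sigma_2)D^{R_3}_{i_3j_3}(\sigma_3)\,\sigma_1\otimes\sigma_2\otimes\sigma_3 .$$ **(a) Centralizer description.** Let $\mathcal K(n)\subset\mathbb C(S_n)^{\otimes2}$ be the subalgebra of elements invariant under conjugation by all $\gamma\otimes\gamma$, $\gamma\in S_n$, with centre $\mathcal Z(\mathcal K(n))$, and let $$z_{R_1,R_2;R_3}=(z_{R_1}\otimes z_{R_2})\cdot\sum_{\sigma\in S_n}\chi^{R_3}(\sigma)\,\sigma\otimes\sigma .$$ The elements $z_{R_1,R_2;R_3}$, for all triples of partitions of $n$, lie in $\mathcal Z(\mathcal K(n))$ and span it, and $$\boldsymbol\delta_2\big(P^{R_1,R_2,R_3};z_{R_1',R_2';R_3'}\big)=n!\,\delta_{R_1R_1'}\delta_{R_2R_2'}\delta_{R_3R_3'}\,\mathsf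 C(R_1,R_2,R_3).$$ Moreover $\dim\mathcal Z(\mathcal K(n))$ is the number of triples with $\mathsf C(R_1,R_2,R_3)\neq0$. For $n\ge2$ this number is smaller than the number $p(n)^3$ of all triples, and the family is linearly dependent: it is an overcomplete basis of the centre. **(b) Double coset description.** Let $\mathcal K_{\rm un}(n)\subset\mathbb C(S_n)^{\otimes3}$ be the subalgebra (with its own unit) of elements invariant under left and right multiplication by all $\gamma\otimes\gamma\otimes\gamma$, let $z_{\rm un}^{R_1,R_2,R_3}=z_{R_1}\otimes z_{R_2}\otimes z_{R_3}$, and let $\mathcal A$ be the linear map $$\mathcal A(\sigma_1\otimes\sigma_2\otimes\sigma_3)=\frac1{(n!)^2}\sum_{\gamma_1,\gamma_2\in S_n}\gamma_1\sigma_1\gamma_2\otimes\gamma_1\sigma_2\gamma_2\otimes\gamma_1\sigma_3\gamma_2$$ sending a triple of permutations to the element of $\mathcal K_{\rm un}(n)$ given by its double coset. The $z_{\rm un}^{R_1,R_2,R_3}$ are central in $\mathbb C(S_n)^{\otimes3}$; their classes $\mathcal A(z_{\rm un}^{R_1,R_2,R_3})$ lie in $\mathcal Z(\mathcal K_{\rm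 un}(n))$ and span it; and $$\boldsymbol\delta_3\big(z_{\rm un}^{R_1',R_2',R_3'};P_{\rm un}^{R_1,R_2,R_3}\big)=\boldsymbol\delta_3\big(\mathcal A(z_{\rm un}^{R_1',R_2',R_3'});P_{\rm un}^{R_1,R_2,R_3}\big)=d(R_3)\,\mathsf C(R_1,R_2,R_3)\,\delta_{R_1R_1'}\delta_{R_2R_2'}\delta_{R_3R_3'}.$$ Again $\dim\mathcal Z(\mathcal K_{\rm un}(n))$ is the number of triples with non-vanishing Kronecker coefficient, and for $n\ge2$ the family $\mathcal A(z_{\rm un}^{R_1,R_2,R_3})$ is linearly dependent. -/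

import Mathlib

open scoped TensorProduct

noncomputable section

namespace KroneckerAlgebra

/-! ### Irreducible representations of the symmetric group -/

/-- The symmetric group `S_n`. -/
abbrev S (n : ℕ) : Type := Equiv.Perm (Fin n)

/-- The Young diagram of a partition `R` of `n`: its row lengths are the parts of `R` in
decreasing order. -/
def diagram {n : ℕ} (R : n.Partition) : YoungDiagram :=
  YoungDiagram.ofRowLens (R.parts.sort (· ≥ ·)) (Multiset.pairwise_sort R.parts (· ≥ ·)).sortedGE

theorem card_cellsOfRowLens (w : List ℕ) :
    (YoungDiagram.cellsOfRowLens w).card = w.sum := by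
  induction w with
  | nil => rfl
  | cons a w ih =>
    rw [YoungDiagram.cellsOfRowLens, Finset.card_union_of_disjoint]
    · simp [ih]
    · rw [Finset.disjoint_left]
      rintro ⟨i, j⟩ h1 h2
      simp only [Finset.mem_product, Finset.mem_singleton] at h1
      simp only [Finset.mem_map] at h2
      obtain ⟨⟨i', j'⟩, -, h⟩ := h2
      have := congrArg Prod.fst h
      simp at this
      omega

theorem card_diagram {n : ℕ} (R : n.Partition) : Fintype.card (diagram R).cells = n := by
  rw [Fintype.card_coe]
  change (YoungDiagram.cellsOfRowLens _).card = n
  rw [card_cellsOfRowLens, ← Multiset.sum_coe, Multiset.sort_eq, R.parts_sum]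

/-- A Young tableau of shape `R`: a filling of the boxes of the diagram by the `n` letters. -/
def tableau {n : ℕ} (R : n.Partition) : Fin n ≃ (diagram R).cells :=
  Fintype.equivOfCardEq (by rw [Fintype.card_fin, card_diagram])

/-- The row of the tableau in which a letter stands. -/
def rowOf {n : ℕ} (R : n.Partition) (i : Fin n) : ℕ := (tableau R i : ℕ × ℕ).1

/-- The column of the tableau in which a letter stands. -/
def colOf {n : ℕ} (R : n.Partition) (i : Fin n) : ℕ := (tableau R i : ℕ × ℕ).2

/-- The Young symmetrizer: (sum of the permutations preserving the rows) times (signed sum of the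
permutations preserving the columns), in `ℝ[S_n]`. -/
def youngSymmetrizer {n : ℕ} (R : n.Partition) : MonoidAlgebra ℝ (S n) :=
  (∑ p : S n with ∀ i, rowOf R (p i) = rowOf R i, MonoidAlgebra.single p (1 : ℝ)) *
  (∑ q : S n with ∀ i, colOf R (q i) = colOf R i,
    MonoidAlgebra.single q (((Equiv.Perm.sign q : ℤ) : ℝ)))

/-- The Specht module `V_R`: the left ideal of `ℝ[S_n]` generated by the Young symmetrizer. -/
def specht {n : ℕ} (R : n.Partition) : Ideal (MonoidAlgebra ℝ (S n)) :=
  Ideal.span {youngSymmetrizer R}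

/-- The irreducible representation of `S_n` labelled by `R`, by left multiplication on `V_R`. -/
def spechtRep {n : ℕ} (R : n.Partition) : Representation ℝ (S n) (specht R) where
  toFun σ :=
    { toFun := fun v => ⟨MonoidAlgebra.single σ 1 * (v : MonoidAlgebra ℝ (S n)), (specht R).mul_mem_left _ v.2⟩
      map_add' := fun v w => Subtype.ext (mul_add _ _ _)
      map_smul' := fun c v => Subtype.ext (mul_smul_comm c _ _) }
  map_one' := LinearMap.ext fun v => Subtype.ext (one_mul _)
  map_mul' σ τ := LinearMap.ext fun v => Subtype.ext (by
    change MonoidAlgebra.single (σ * τ) (1 : ℝ) * (v : MonoidAlgebra ℝ (S n)) =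
      MonoidAlgebra.single σ 1 * (MonoidAlgebra.single τ 1 * (v : MonoidAlgebra ℝ (S n)))
    rw [← mul_assoc, MonoidAlgebra.single_mul_single, one_mul])

/-- The dimension `d(R)`. -/
def dim {n : ℕ} (R : n.Partition) : ℕ := Module.finrank ℝ (specht R)

/-- The irreducible character `χ^R`. -/
def chi {n : ℕ} (R : n.Partition) (σ : S n) : ℝ :=
  LinearMap.trace ℝ (specht R) (spechtRep R σ)

/-- The Kronecker coefficient `C(R₁,R₂,R₃) = (1/n!) ∑_σ χ^{R₁}(σ) χ^{R₂}(σ) χ^{R₃}(σ)`. -/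
def kronecker {n : ℕ} (R₁ R₂ R₃ : n.Partition) : ℝ :=
  (n.factorial : ℝ)⁻¹ * ∑ σ : S n, chi R₁ σ * chi R₂ σ * chi R₃ σ

/-- A choice, for every `R`, of a basis of `V_R` in which all permutations act by (real)
orthogonal matrices. -/
structure OrthogonalBases (n : ℕ) where
  basis (R : n.Partition) : Module.Basis (Fin (dim R)) ℝ (specht R)
  orthogonal (R : n.Partition) (σ : S n) :
    LinearMap.toMatrix (basis R) (basis R) (spechtRep R σ) ∈
      Matrix.orthogonalGroup (Fin (dim R)) ℝ

/-- The representation matrix `D^R(σ)`. -/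
def OrthogonalBases.D {n : ℕ} (B : OrthogonalBases n) (R : n.Partition) (σ : S n) :
    Matrix (Fin (dim R)) (Fin (dim R)) ℝ :=
  LinearMap.toMatrix (B.basis R) (B.basis R) (spechtRep R σ)

/-- Clebsch-Gordan coefficients `C^{R₁,R₂;R₃,τ}_{i₁,i₂;i₃}`: the real orthogonal matrices of the
changes of basis from the product bases `|R₁,i₁⟩ ⊗ |R₂,i₂⟩` of the representations `V_{R₁} ⊗ V_{R₂}`
to bases `|R₃,τ,i₃⟩` in which `S_n` acts, for fixed `R₃` and `τ`, through the matrices `D^{R₃}`.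
The number of values of `τ` is the number `mult R₁ R₂ R₃` of copies of `V_{R₃}`. -/
structure ClebschGordan {n : ℕ} (B : OrthogonalBases n) where
  mult (R₁ R₂ R₃ : n.Partition) : ℕ
  coeff (R₁ R₂ R₃ : n.Partition) (τ : Fin (mult R₁ R₂ R₃))
    (i₁ : Fin (dim R₁)) (i₂ : Fin (dim R₂)) (i₃ : Fin (dim R₃)) : ℝ
  intertwines (R₁ R₂ R₃ : n.Partition) (τ : Fin (mult R₁ R₂ R₃)) (γ : S n)
    (i₁ : Fin (dim R₁)) (i₂ : Fin (dim R₂)) (j₃ : Fin (dim R₃)) :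
    ∑ j₁, ∑ j₂, B.D R₁ γ i₁ j₁ * B.D R₂ γ i₂ j₂ * coeff R₁ R₂ R₃ τ j₁ j₂ j₃ =
      ∑ i₃, coeff R₁ R₂ R₃ τ i₁ i₂ i₃ * B.D R₃ γ i₃ j₃
  orthonormal (R₁ R₂ : n.Partition)
    (a b : Σ R₃ : n.Partition, Fin (mult R₁ R₂ R₃) × Fin (dim R₃)) :
    ∑ i₁, ∑ i₂, coeff R₁ R₂ a.1 a.2.1 i₁ i₂ a.2.2 * coeff R₁ R₂ b.1 b.2.1 i₁ i₂ b.2.2 =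
      open scoped Classical in if a = b then 1 else 0
  complete (R₁ R₂ : n.Partition) (i₁ j₁ : Fin (dim R₁)) (i₂ j₂ : Fin (dim R₂)) :
    ∑ R₃, ∑ τ, ∑ i₃, coeff R₁ R₂ R₃ τ i₁ i₂ i₃ * coeff R₁ R₂ R₃ τ j₁ j₂ i₃ =
      if i₁ = j₁ ∧ i₂ = j₂ then 1 else 0

/-! ### Group algebras and pairings -/

/-- The group algebra `ℂ(S_n)`. -/
def A (n : ℕ) : Type := MonoidAlgebra ℂ (S n)

instance (n : ℕ) : Ring (A n) := inferInstanceAs (Ring (MonoidAlgebra ℂ (S n)))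

instance (n : ℕ) : Algebra ℂ (A n) := inferInstanceAs (Algebra ℂ (MonoidAlgebra ℂ (S n)))

/-- `ℂ(S_n) ⊗ ℂ(S_n)`. -/
abbrev A₂ (n : ℕ) : Type := A n ⊗[ℂ] A n

/-- `ℂ(S_n) ⊗ ℂ(S_n) ⊗ ℂ(S_n)`. -/
abbrev A₃ (n : ℕ) : Type := A n ⊗[ℂ] A n ⊗[ℂ] A n

/-- A permutation as an element of the group algebra. -/
def el {n : ℕ} (σ : S n) : A n := (MonoidAlgebra.single σ 1 : MonoidAlgebra ℂ (S n))

/-- The coefficient of a permutation in an element of the group algebra. -/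
def coeff {n : ℕ} (σ : S n) : A n →ₗ[ℂ] ℂ where
  toFun x := MonoidAlgebra.coeff (R := ℂ) (M := S n) x σ
  map_add' _ _ := rfl
  map_smul' _ _ := rfl

/-- The bilinear pairing `δ(∑ c_σ σ; ∑ c'_σ σ) = ∑ c_σ c'_σ` on `ℂ(S_n)`. -/
def pairing₁ (n : ℕ) : LinearMap.BilinForm ℂ (A n) :=
  LinearMap.mk₂ ℂ (fun x y => ∑ σ : S n, coeff σ x * coeff σ y)
    (fun x x' y => by simp [add_mul, Finset.sum_add_distrib])
    (fun c x y => by simp [mul_assoc, Finset.mul_sum])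
    (fun x y y' => by simp [mul_add, Finset.sum_add_distrib])
    (fun c x y => by simp [mul_left_comm, Finset.mul_sum])

/-- The bilinear pairing `δ₂` on `ℂ(S_n)^{⊗2}`. -/
def pairing₂ (n : ℕ) : LinearMap.BilinForm ℂ (A₂ n) := (pairing₁ n).tmul (pairing₁ n)

/-- The bilinear pairing `δ₃` on `ℂ(S_n)^{⊗3}`. -/
def pairing₃ (n : ℕ) : LinearMap.BilinForm ℂ (A₃ n) := (pairing₂ n).tmul (pairing₁ n)

/-! ### The algebra `𝒦(n)`: centralizer description -/

/-- The subalgebra `𝒦(n)` of `ℂ(S_n) ⊗ ℂ(S_n)` of the elements invariant under conjugation by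
the diagonally embedded `S_n`. -/
def K (n : ℕ) : Subalgebra ℂ (A₂ n) :=
  Subalgebra.centralizer ℂ (Set.range fun γ : S n => el γ ⊗ₜ[ℂ] el γ)

/-- The centre of `𝒦(n)`, as a subspace of `ℂ(S_n) ⊗ ℂ(S_n)`. -/
def centreK (n : ℕ) : Submodule ℂ (A₂ n) :=
  (Subalgebra.toSubmodule (Subalgebra.center ℂ (K n))).map (K n).val.toLinearMap

/-- The central element `z_R = ∑_σ χ^R(σ) σ` of `ℂ(S_n)`. -/
def z {n : ℕ} (R : n.Partition) : A n := ∑ σ : S n, (chi R σ : ℂ) • el σ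

/-- `z_{R₁,R₂;R₃} = (z_{R₁} ⊗ z_{R₂}) · ∑_σ χ^{R₃}(σ) σ ⊗ σ`. -/
def zTriple {n : ℕ} (R₁ R₂ R₃ : n.Partition) : A₂ n :=
  (z R₁ ⊗ₜ[ℂ] z R₂) * ∑ σ : S n, (chi R₃ σ : ℂ) • (el σ ⊗ₜ[ℂ] el σ)

/-- The Fourier element `Q^{R₁,R₂,R₃}_{τ₁,τ₂}`. -/
def Q {n : ℕ} {B : OrthogonalBases n} (cg : ClebschGordan B) (R₁ R₂ R₃ : n.Partition)
    (τ₁ τ₂ : Fin (cg.mult R₁ R₂ R₃)) : A₂ n :=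
  ((dim R₁ * dim R₂ : ℂ) / (n.factorial : ℂ) ^ 2) •
    ∑ σ₁ : S n, ∑ σ₂ : S n,
      ((∑ i₁, ∑ i₂, ∑ i₃, ∑ j₁, ∑ j₂,
        cg.coeff R₁ R₂ R₃ τ₁ i₁ i₂ i₃ * cg.coeff R₁ R₂ R₃ τ₂ j₁ j₂ i₃ *
          B.D R₁ σ₁ i₁ j₁ * B.D R₂ σ₂ i₂ j₂ : ℝ) : ℂ) • (el σ₁ ⊗ₜ[ℂ] el σ₂)

/-- `P^{R₁,R₂,R₃} = ∑_τ Q^{R₁,R₂,R₃}_{τ,τ}`. -/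
def P {n : ℕ} {B : OrthogonalBases n} (cg : ClebschGordan B) (R₁ R₂ R₃ : n.Partition) : A₂ n :=
  ∑ τ, Q cg R₁ R₂ R₃ τ τ

/-! ### The algebra `𝒦_un(n)`: double coset description -/

/-- The diagonal element `γ ⊗ γ ⊗ γ`. -/
def diag₃ {n : ℕ} (γ : S n) : A₃ n := el γ ⊗ₜ[ℂ] el γ ⊗ₜ[ℂ] el γ

/-- The (not necessarily containing `1 ⊗ 1 ⊗ 1`) subalgebra `𝒦_un(n)` of `ℂ(S_n)^{⊗3}` of the
elements invariant under left and right multiplication by the diagonally embedded `S_n`. -/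
def Kun (n : ℕ) : NonUnitalSubalgebra ℂ (A₃ n) where
  carrier := {x | ∀ γ : S n, diag₃ γ * x = x ∧ x * diag₃ γ = x}
  add_mem' := fun hx hy γ => by
    simp only [mul_add, add_mul, (hx γ).1, (hx γ).2, (hy γ).1, (hy γ).2, and_self]
  zero_mem' := fun γ => by simp
  mul_mem' := fun {x y} hx hy γ => by
    rw [← mul_assoc, (hx γ).1, mul_assoc, (hy γ).2]; exact ⟨rfl, rfl⟩
  smul_mem' := fun c x hx γ => by
    rw [mul_smul_comm, smul_mul_assoc, (hx γ).1, (hx γ).2]; exact ⟨rfl, rfl⟩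

/-- The centre of `𝒦_un(n)`, as a subspace of `ℂ(S_n)^{⊗3}`. -/
def centreKun (n : ℕ) : Submodule ℂ (A₃ n) :=
  (NonUnitalSubalgebra.center ℂ (Kun n)).toSubmodule.map (Kun n).toSubmodule.subtype

/-- `z_un^{R₁,R₂,R₃} = z_{R₁} ⊗ z_{R₂} ⊗ z_{R₃}`. -/
def zUn {n : ℕ} (R₁ R₂ R₃ : n.Partition) : A₃ n := z R₁ ⊗ₜ[ℂ] z R₂ ⊗ₜ[ℂ] z R₃

/-- The linear map `σ₁ ⊗ σ₂ ⊗ σ₃ ↦ (1/n!²) ∑_{γ₁,γ₂} γ₁σ₁γ₂ ⊗ γ₁σ₂γ₂ ⊗ γ₁σ₃γ₂`, which sends a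
triple of permutations to the normalized element of `𝒦_un(n)` of its double coset. -/
def cosetMap (n : ℕ) : A₃ n →ₗ[ℂ] A₃ n :=
  ((n.factorial : ℂ) ^ 2)⁻¹ • ∑ γ₁ : S n, ∑ γ₂ : S n,
    LinearMap.mulLeft ℂ (diag₃ γ₁) ∘ₗ LinearMap.mulRight ℂ (diag₃ γ₂)

/-- The Fourier element `Q_un^{R₁,R₂,R₃}_{τ₁,τ₂}`. -/
def Qun {n : ℕ} {B : OrthogonalBases n} (cg : ClebschGordan B) (R₁ R₂ R₃ : n.Partition)
    (τ₁ τ₂ : Fin (cg.mult R₁ R₂ R₃)) : A₃ n :=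
  ((dim R₁ * dim R₂ * dim R₃ : ℂ) / (n.factorial : ℂ) ^ 3) •
    ∑ σ₁ : S n, ∑ σ₂ : S n, ∑ σ₃ : S n,
      ((∑ i₁, ∑ i₂, ∑ i₃, ∑ j₁, ∑ j₂, ∑ j₃,
        cg.coeff R₁ R₂ R₃ τ₁ i₁ i₂ i₃ * cg.coeff R₁ R₂ R₃ τ₂ j₁ j₂ j₃ *
          B.D R₁ σ₁ i₁ j₁ * B.D R₂ σ₂ i₂ j₂ * B.D R₃ σ₃ i₃ j₃ : ℝ) : ℂ) •
        (el σ₁ ⊗ₜ[ℂ] el σ₂ ⊗ₜ[ℂ] el σ₃)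

/-- `P_un^{R₁,R₂,R₃} = ∑_τ Q_un^{R₁,R₂,R₃}_{τ,τ}`. -/
def Pun {n : ℕ} {B : OrthogonalBases n} (cg : ClebschGordan B) (R₁ R₂ R₃ : n.Partition) : A₃ n :=
  ∑ τ, Qun cg R₁ R₂ R₃ τ τ

/-- The number of triples of partitions of `n` with non-vanishing Kronecker coefficient. -/
def numNonvanishing (n : ℕ) : ℕ :=
  Nat.card {t : n.Partition × n.Partition × n.Partition // kronecker t.1 t.2.1 t.2.2 ≠ 0}

end KroneckerAlgebra

end

/-! The centres are computed in the double coset algebra and then carried over to the centralizer.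
Let e be the average of the elements γ ⊗ γ ⊗ γ. It is an idempotent, 𝒦_un is the corner e
ℂ(S_n)^{⊗3} e, and `cosetMap` is x ↦ e x e. Since ℂ(S_n)^{⊗3} is a product of matrix blocks with
central idempotents p_t, one for each triple t, a central element of the corner is a multiple of e
on every block (`exists_mul_eq_smul_of_corner`). Hence the e p_t span the centre, and they are
nonzero multiples of the classes of the z_un (`span_cosetMap_zUn`).

If the Kronecker coefficient of t vanishes, then e p_t = 0, because e averages the matrices D ⊗ D ⊗
D, which contain no invariant vector (`cosetMap_zUn_eq_zero`). The remaining classes are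
independent, because the P_un are dual to them up to the nonzero factors d(R₃) C(R₁,R₂,R₃)
(`pairing₃_cosetMap_zUn_Pun`). This gives the dimension. The map x ↦ (x ⊗ 1) e is an isomorphism of
𝒦 onto 𝒦_un taking z_{R₁,R₂;R₃} to the class of z_un (`map_centreK`, `toDoubleCoset_zTriple`), so
part (a) follows from part (b), except for its pairing, which is a separate computation.
Overcompleteness needs a single vanishing coefficient: C(R,R',(n)) = 0 for R ≠ R'.

The representation theory is built from Young symmetrizers over ℝ. The relations c_R x c_R' = 0 for
R ≠ R' and c_R x c_R ∈ ℝ c_R give Schur's lemma, with real scalars, directly. Invariance of the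
standard scalar product on ℝ[S_n] gives orthogonal bases, and Schur's lemma then gives orthogonality
of matrix entries. Counting partitions against conjugacy classes gives completeness
(`sum_dim_mul_chi`), which says that the matrix units sum to 1. The same matrix units, formed in an
arbitrary algebra on which S_n is represented, yield the blocks of ℂ(S_n) and also the
Clebsch–Gordan coefficients. -/

namespace KroneckerAlgebra

/-! ### Combinatorics of tableaux: dominance and the factorization g = pq -/

section Tableaux

variable {n : ℕ}

theorem eq_of_rowOf_colOf (R : n.Partition) {i j : Fin n} (hr : rowOf R i = rowOf R j)
    (hc : colOf R i = colOf R j) : i = j :=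
  (tableau R).injective (Subtype.ext (Prod.ext hr hc))

theorem rowOf_colOf_mem (R : n.Partition) (i : Fin n) : (rowOf R i, colOf R i) ∈ diagram R :=
  (tableau R i).2

theorem exists_letter (R : n.Partition) {r c : ℕ} (h : (r, c) ∈ diagram R) :
    ∃ i, rowOf R i = r ∧ colOf R i = c :=
  ⟨(tableau R).symm ⟨(r, c), h⟩, by simp [rowOf], by simp [colOf]⟩

/-- No two letters in the same row of `R` are, after applying `g⁻¹`, in the same column of
`R'`. -/
def Transversal (R R' : n.Partition) (g : S n) : Prop :=
  ∀ i j, rowOf R i = rowOf R j → colOf R' (g⁻¹ i) = colOf R' (g⁻¹ j) → i = j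

/-- The letters of the first k rows of R that land in column c of R' lie in different rows, so there
are at most k of them, and at most as many as the column has boxes. The smaller of these two bounds
is the number of boxes of the column in the first k rows of R'. -/
theorem Transversal.card_le {R R' : n.Partition} {g : S n} (h : Transversal R R' g) (k c : ℕ) :
    (Finset.univ.filter fun i => rowOf R i < k ∧ colOf R' (g⁻¹ i) = c).card ≤
      (Finset.univ.filter fun i => rowOf R' i < k ∧ colOf R' i = c).card := by
  by_cases hk : ∀ i, colOf R' i = c → rowOf R' i < k
  · refine Finset.card_le_card_of_injOn (fun i => g⁻¹ i) ?_ (g⁻¹).injective.injOn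
    intro i hi
    simp only [Finset.coe_filter, Finset.mem_univ, true_and, Set.mem_ofPred_eq] at hi ⊢
    exact ⟨hk _ hi.2, hi.2⟩
  · push Not at hk
    obtain ⟨i₀, hi₀, hk⟩ := hk
    have h1 : (Finset.univ.filter fun i => rowOf R i < k ∧ colOf R' (g⁻¹ i) = c).card ≤
        (Finset.range k).card := by
      refine Finset.card_le_card_of_injOn (rowOf R) ?_ ?_
      · intro i hi
        simp only [Finset.coe_filter, Finset.mem_univ, true_and, Set.mem_ofPred_eq] at hi
        simpa using hi.1
      · intro i hi j hj hij
        simp only [Finset.coe_filter, Finset.mem_univ, true_and, Set.mem_ofPred_eq] at hi hj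
        exact h i j hij (hi.2.trans hj.2.symm)
    refine h1.trans ?_
    have h2 : Finset.range k ⊆
        (Finset.univ.filter fun i => rowOf R' i < k ∧ colOf R' i = c).image (rowOf R') := by
      intro r hr
      rw [Finset.mem_range] at hr
      obtain ⟨j, hj, hj'⟩ := exists_letter R' ((diagram R').up_left_mem (i1 := r) (j1 := c)
        (hr.le.trans hk) le_rfl (hi₀ ▸ rowOf_colOf_mem R' i₀))
      rw [Finset.mem_image]
      exact ⟨j, by simp [hj, hj', hr], hj⟩
    exact (Finset.card_le_card h2).trans Finset.card_image_le

theorem card_rowOf_lt_eq_sum (R R' : n.Partition) (g : S n) (k : ℕ) :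
    (Finset.univ.filter fun i => rowOf R i < k).card =
      ∑ c ∈ Finset.univ.image (colOf R'),
        (Finset.univ.filter fun i => rowOf R i < k ∧ colOf R' (g⁻¹ i) = c).card := by
  rw [Finset.card_eq_sum_card_fiberwise (f := fun i => colOf R' (g⁻¹ i))
    (t := Finset.univ.image (colOf R')) (fun i _ => by simp)]
  simp only [Finset.filter_filter]

/-- Summation over the columns: a transversal pair forces R' to dominate R. -/
theorem Transversal.card_rowOf_lt_le {R R' : n.Partition} {g : S n} (h : Transversal R R' g)
    (k : ℕ) :
    (Finset.univ.filter fun i => rowOf R i < k).card ≤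
      (Finset.univ.filter fun i => rowOf R' i < k).card := by
  rw [card_rowOf_lt_eq_sum R R' g, card_rowOf_lt_eq_sum R' R' 1]
  exact Finset.sum_le_sum fun c _ => h.card_le k c

/-- For R = R' both sides of the dominance inequality agree, so the column-wise inequalities of
`Transversal.card_le` are all equalities. This determines which rows the letters of each column come
from. -/
theorem Transversal.mem_diagram {R : n.Partition} {g : S n} (h : Transversal R R g)
    (i : Fin n) : (rowOf R i, colOf R (g⁻¹ i)) ∈ diagram R := by
  have key : ∀ k, (Finset.univ.filter fun j => rowOf R j < k ∧
      colOf R (g⁻¹ j) = colOf R (g⁻¹ i)).card =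
      (Finset.univ.filter fun j => rowOf R j < k ∧ colOf R j = colOf R (g⁻¹ i)).card := by
    intro k
    have h1 := card_rowOf_lt_eq_sum R R g k
    rw [card_rowOf_lt_eq_sum R R 1] at h1
    exact ((Finset.sum_eq_sum_iff_of_le fun c _ => h.card_le k c).1 h1.symm _ (by simp))
  -- Were the box missing, the count of boxes in this column would not grow when the row of i is
  -- added, whereas the count of letters does grow, since i itself is new.
  by_contra hmem
  have h1 : (Finset.univ.filter fun j => rowOf R j < rowOf R i + 1 ∧
      colOf R j = colOf R (g⁻¹ i)) =
      (Finset.univ.filter fun j => rowOf R j < rowOf R i ∧ colOf R j = colOf R (g⁻¹ i)) := by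
    ext j
    simp only [Finset.mem_filter, Finset.mem_univ, true_and]
    refine ⟨fun hj => ⟨lt_of_le_of_ne (Nat.lt_succ_iff.1 hj.1) fun he => hmem ?_, hj.2⟩,
      fun hj => ⟨hj.1.trans (Nat.lt_succ_self _), hj.2⟩⟩
    rw [← he, ← hj.2]
    exact rowOf_colOf_mem R j
  have h2 := key (rowOf R i + 1)
  rw [h1, ← key] at h2
  have h3 := Finset.eq_of_subset_of_card_le (fun j hj => by
    simp only [Finset.mem_filter, Finset.mem_univ, true_and] at hj ⊢
    exact ⟨hj.1.trans (Nat.lt_succ_self _), hj.2⟩) h2.le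
  have h4 : i ∈ (Finset.univ.filter fun j => rowOf R j < rowOf R i ∧
      colOf R (g⁻¹ j) = colOf R (g⁻¹ i)) := by
    rw [h3]; simp
  simp at h4

/-- The permutation preserves the rows of the tableau. -/
def PreservesRows (R : n.Partition) (p : S n) : Prop := ∀ i, rowOf R (p i) = rowOf R i

/-- The permutation preserves the columns of the tableau. -/
def PreservesCols (R : n.Partition) (q : S n) : Prop := ∀ i, colOf R (q i) = colOf R i

/-- Each letter i can be moved along its row to the column of g⁻¹ i, since that box exists;
transversality makes this map injective. Composed with g it preserves columns, so its inverse is the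
required row permutation. -/
theorem Transversal.exists_mul {R : n.Partition} {g : S n} (h : Transversal R R g) :
    ∃ p q, PreservesRows R p ∧ PreservesCols R q ∧ g = p * q := by
  choose f hf hf' using fun i => exists_letter R (h.mem_diagram i)
  have hinj : Function.Injective f := fun i j hij =>
    h i j (by rw [← hf i, hij, hf]) (by rw [← hf' i, hij, hf'])
  let p : S n := Equiv.ofBijective f (Finite.injective_iff_bijective.1 hinj)
  have hp : ∀ i, p i = f i := fun i => rfl
  refine ⟨p⁻¹, p * g, fun i => ?_, fun i => ?_, by group⟩
  · obtain ⟨j, rfl⟩ := p.surjective i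
    rw [Equiv.Perm.inv_eq_iff_eq.2 rfl, hp, hf]
  · rw [Equiv.Perm.mul_apply, hp, hf', Equiv.Perm.inv_eq_iff_eq.2 rfl]

theorem card_rowOf_eq (R : n.Partition) (r : ℕ) :
    (Finset.univ.filter fun i => rowOf R i = r).card = (diagram R).rowLen r := by
  rw [YoungDiagram.rowLen_eq_card]
  refine Finset.card_bij (fun i _ => (rowOf R i, colOf R i)) ?_ ?_ ?_
  · intro i hi
    rw [YoungDiagram.mem_row_iff]
    exact ⟨rowOf_colOf_mem R i, by simpa using hi⟩
  · intro i _ j _ hij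
    exact eq_of_rowOf_colOf R (congrArg Prod.fst hij) (congrArg Prod.snd hij)
  · rintro ⟨a, c⟩ hb
    rw [YoungDiagram.mem_row_iff] at hb
    obtain ⟨i, h1, h2⟩ := exists_letter R hb.1
    exact ⟨i, by simpa [h1] using hb.2, by rw [h1, h2]⟩

theorem diagram_injective : Function.Injective (diagram : n.Partition → YoungDiagram) := by
  intro R R' h
  have key : ∀ R : n.Partition, (diagram R).rowLens = R.parts.sort (· ≥ ·) := fun R =>
    YoungDiagram.rowLens_ofRowLens_eq_self fun x hx => R.parts_pos (by simpa using hx)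
  have h1 := (key R).symm.trans ((congrArg _ h).trans (key R'))
  ext1
  rw [← Multiset.sort_eq R.parts (· ≥ ·), h1, Multiset.sort_eq]

theorem eq_of_card_rowOf_lt {R R' : n.Partition}
    (h : ∀ k, (Finset.univ.filter fun i => rowOf R i < k).card =
      (Finset.univ.filter fun i => rowOf R' i < k).card) : R = R' := by
  have key : ∀ (R : n.Partition) (k : ℕ), (Finset.univ.filter fun i => rowOf R i < k + 1).card =
      (Finset.univ.filter fun i => rowOf R i < k).card + (diagram R).rowLen k := by
    intro R k
    rw [← card_rowOf_eq, ← Finset.card_union_of_disjoint]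
    · congr 1
      ext i
      simp [← le_iff_lt_or_eq]
    · rw [Finset.disjoint_filter]
      intro i _ h1 h2
      omega
  refine diagram_injective (SetLike.ext fun x => ?_)
  obtain ⟨r, c⟩ := x
  have h1 := key R r
  rw [h, key R', h] at h1
  rw [YoungDiagram.mem_iff_lt_rowLen, YoungDiagram.mem_iff_lt_rowLen, Nat.add_left_cancel h1]

/-- Dominance in both directions forces equal row lengths, so it can hold in only one direction
between different shapes. -/
theorem not_transversal_or {R R' : n.Partition} (h : R ≠ R') :
    (∀ g, ¬ Transversal R R' g) ∨ ∀ g, ¬ Transversal R' R g := by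
  by_contra! hc
  obtain ⟨⟨g, hg⟩, ⟨g', hg'⟩⟩ := hc
  exact h (eq_of_card_rowOf_lt fun k => (hg.card_rowOf_lt_le k).antisymm (hg'.card_rowOf_lt_le k))

end Tableaux

/-! ### Young symmetrizers: orthogonality and quasi-idempotence -/

section YoungSymmetrizer

variable {n : ℕ}

/-- The sum of the permutations preserving the rows. -/
noncomputable def rowSum (R : n.Partition) : MonoidAlgebra ℝ (S n) :=
  ∑ p : S n with ∀ i, rowOf R (p i) = rowOf R i, MonoidAlgebra.single p (1 : ℝ)

/-- The signed sum of the permutations preserving the columns. -/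
noncomputable def colSum (R : n.Partition) : MonoidAlgebra ℝ (S n) :=
  ∑ q : S n with ∀ i, colOf R (q i) = colOf R i,
    MonoidAlgebra.single q (((Equiv.Perm.sign q : ℤ) : ℝ))

theorem youngSymmetrizer_eq (R : n.Partition) : youngSymmetrizer R = rowSum R * colSum R := rfl

theorem rowSum_mul_single {R : n.Partition} {p : S n} (hp : PreservesRows R p) :
    rowSum R * MonoidAlgebra.single p 1 = rowSum R := by
  rw [rowSum, Finset.sum_mul]
  refine Finset.sum_equiv (Equiv.mulRight p) (fun g => ?_) (fun g _ => ?_)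
  · simp only [Finset.mem_filter, Finset.mem_univ, true_and, Equiv.coe_mulRight,
      Equiv.Perm.mul_apply]
    refine ⟨fun h i => (h _).trans (hp i), fun h i => ?_⟩
    obtain ⟨j, rfl⟩ := p.surjective i
    rw [h, hp]
  · rw [MonoidAlgebra.single_mul_single, one_mul, Equiv.coe_mulRight]

theorem single_mul_rowSum {R : n.Partition} {p : S n} (hp : PreservesRows R p) :
    MonoidAlgebra.single p 1 * rowSum R = rowSum R := by
  rw [rowSum, Finset.mul_sum]
  refine Finset.sum_equiv (Equiv.mulLeft p) (fun g => ?_) (fun g _ => ?_)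
  · simp only [Finset.mem_filter, Finset.mem_univ, true_and, Equiv.coe_mulLeft,
      Equiv.Perm.mul_apply, hp _]
  · rw [MonoidAlgebra.single_mul_single, one_mul, Equiv.coe_mulLeft]

theorem sign_mul_sign (q g : S n) : (((Equiv.Perm.sign q : ℤ) : ℝ)) *
    (((Equiv.Perm.sign (q * g) : ℤ) : ℝ)) = ((Equiv.Perm.sign g : ℤ) : ℝ) := by
  rw [Equiv.Perm.sign_mul]
  obtain h | h := Int.units_eq_one_or (Equiv.Perm.sign q) <;> simp [h]

theorem single_mul_colSum {R : n.Partition} {q : S n} (hq : PreservesCols R q) :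
    MonoidAlgebra.single q 1 * colSum R = ((Equiv.Perm.sign q : ℤ) : ℝ) • colSum R := by
  rw [colSum, Finset.mul_sum, Finset.smul_sum]
  refine Finset.sum_equiv (Equiv.mulLeft q) (fun g => ?_) (fun g _ => ?_)
  · simp only [Finset.mem_filter, Finset.mem_univ, true_and, Equiv.coe_mulLeft,
      Equiv.Perm.mul_apply, hq _]
  · rw [MonoidAlgebra.single_mul_single, one_mul, Equiv.coe_mulLeft, MonoidAlgebra.smul_single,
      smul_eq_mul, sign_mul_sign]

theorem colSum_mul_single {R : n.Partition} {q : S n} (hq : PreservesCols R q) :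
    colSum R * MonoidAlgebra.single q 1 = ((Equiv.Perm.sign q : ℤ) : ℝ) • colSum R := by
  rw [colSum, Finset.sum_mul, Finset.smul_sum]
  refine Finset.sum_equiv (Equiv.mulRight q) (fun g => ?_) (fun g _ => ?_)
  · simp only [Finset.mem_filter, Finset.mem_univ, true_and, Equiv.coe_mulRight,
      Equiv.Perm.mul_apply]
    refine ⟨fun h i => (h _).trans (hq i), fun h i => ?_⟩
    obtain ⟨j, rfl⟩ := q.surjective i
    rw [h, hq]
  · rw [MonoidAlgebra.single_mul_single, mul_one, Equiv.coe_mulRight, MonoidAlgebra.smul_single,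
      smul_eq_mul, ← sign_mul_sign q g, Equiv.Perm.sign_mul, Equiv.Perm.sign_mul,
      mul_comm (Equiv.Perm.sign q)]

theorem preservesRows_swap {R : n.Partition} {i j : Fin n} (h : rowOf R i = rowOf R j) :
    PreservesRows R (Equiv.swap i j) := fun k => by
  rw [Equiv.swap_apply_def]; split_ifs with h1 h2 <;> simp_all

theorem preservesCols_swap {R : n.Partition} {i j : Fin n} (h : colOf R i = colOf R j) :
    PreservesCols R (Equiv.swap i j) := fun k => by
  rw [Equiv.swap_apply_def]; split_ifs with h1 h2 <;> simp_all

/-- If two letters stand in the same row of `R` and, after applying `g⁻¹`, in the same column of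
`R'`, a transposition is moved through `g`. -/
theorem exists_swap {R R' : n.Partition} {g : S n} (h : ¬ Transversal R R' g) :
    ∃ i j : Fin n, i ≠ j ∧ PreservesRows R (Equiv.swap i j) ∧
      PreservesCols R' (Equiv.swap (g⁻¹ i) (g⁻¹ j)) ∧
      Equiv.swap i j * g = g * Equiv.swap (g⁻¹ i) (g⁻¹ j) := by
  unfold Transversal at h
  push Not at h
  obtain ⟨i, j, hr, hc, hij⟩ := h
  refine ⟨i, j, hij, preservesRows_swap hr, preservesCols_swap hc, ?_⟩
  rw [Equiv.mul_swap_eq_swap_mul]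
  simp

theorem eq_zero_of_eq_neg {x : MonoidAlgebra ℝ (S n)} (h : x = -x) : x = 0 := by
  have h1 : (2 : ℝ) • x = 0 := by
    rw [two_smul]
    nth_rewrite 2 [h]
    exact add_neg_cancel x
  exact (smul_eq_zero.1 h1).resolve_left two_ne_zero

/-- The transposition provided by `exists_swap` is absorbed by the row sum and, once moved through
g, changes the sign of the column sum. The product is therefore its own negative. -/
theorem rowSum_mul_single_mul_colSum_eq_zero {R R' : n.Partition} {g : S n}
    (h : ¬ Transversal R R' g) : rowSum R * MonoidAlgebra.single g 1 * colSum R' = 0 := by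
  obtain ⟨i, j, hij, hp, hq, he⟩ := exists_swap h
  have h1 : rowSum R * MonoidAlgebra.single g 1 * colSum R' =
      -(rowSum R * MonoidAlgebra.single g 1 * colSum R') := by
    conv_lhs => rw [← rowSum_mul_single hp, mul_assoc (rowSum R),
      MonoidAlgebra.single_mul_single, he, ← MonoidAlgebra.single_mul_single, ← mul_assoc,
      mul_assoc _ _ (colSum R'), single_mul_colSum hq,
      Equiv.Perm.sign_swap (by simpa using hij)]
    simp
  exact eq_zero_of_eq_neg h1

theorem colSum_mul_single_mul_rowSum_eq_zero {R R' : n.Partition} {g : S n}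
    (h : ¬ Transversal R R' g⁻¹) : colSum R' * MonoidAlgebra.single g 1 * rowSum R = 0 := by
  obtain ⟨i, j, hij, hp, hq, he⟩ := exists_swap h
  rw [inv_inv] at hq he
  have he' : Equiv.swap (g i) (g j) * g = g * Equiv.swap i j := by
    rw [Equiv.mul_swap_eq_swap_mul]
  have h1 : colSum R' * MonoidAlgebra.single g 1 * rowSum R =
      -(colSum R' * MonoidAlgebra.single g 1 * rowSum R) := by
    conv_lhs => rw [← single_mul_rowSum hp, ← mul_assoc, mul_assoc (colSum R'),
      MonoidAlgebra.single_mul_single, ← he', ← MonoidAlgebra.single_mul_single, ← mul_assoc,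
      colSum_mul_single hq, Equiv.Perm.sign_swap (by simpa using hij)]
    simp
  exact eq_zero_of_eq_neg h1

theorem induction_single {C : MonoidAlgebra ℝ (S n) → Prop} (x : MonoidAlgebra ℝ (S n))
    (h1 : ∀ g, C (MonoidAlgebra.single g 1)) (h2 : ∀ x y, C x → C y → C (x + y))
    (h3 : ∀ (c : ℝ) x, C x → C (c • x)) : C x :=
  MonoidAlgebra.induction_on x h1 h2 h3

theorem mul_mul_eq_zero {a b : MonoidAlgebra ℝ (S n)}
    (h : ∀ g : S n, a * MonoidAlgebra.single g 1 * b = 0) (x : MonoidAlgebra ℝ (S n)) :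
    a * x * b = 0 := by
  induction x using induction_single with
  | h1 g => exact h g
  | h2 x y hx hy => rw [mul_add, add_mul, hx, hy, add_zero]
  | h3 c x hx => rw [mul_smul_comm, smul_mul_assoc, hx, smul_zero]

/-- One of the two orders of R and R' admits no transversal. Accordingly either the outer factors
(row sum of R, column sum of R') or the inner factors (column sum of R, row sum of R') annihilate
everything placed between them. -/
theorem youngSymmetrizer_mul_mul_of_ne {R R' : n.Partition} (h : R ≠ R')
    (x : MonoidAlgebra ℝ (S n)) : youngSymmetrizer R * x * youngSymmetrizer R' = 0 := by
  rw [youngSymmetrizer_eq, youngSymmetrizer_eq]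
  obtain h | h := not_transversal_or h
  · have := mul_mul_eq_zero (fun g => rowSum_mul_single_mul_colSum_eq_zero (h g))
      (colSum R * x * rowSum R')
    simpa only [mul_assoc] using this
  · have := mul_mul_eq_zero (fun g => colSum_mul_single_mul_rowSum_eq_zero (h g⁻¹)) x
    rw [mul_assoc (rowSum R), mul_assoc (rowSum R), ← mul_assoc _ (rowSum R'), this, zero_mul,
      mul_zero]

/-- By linearity x is a permutation g. If g = pq, the factors p and q are absorbed up to the sign of
q; otherwise g is not transversal and the product vanishes. -/
theorem exists_rowSum_mul_mul_colSum (R : n.Partition) (x : MonoidAlgebra ℝ (S n)) :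
    ∃ c : ℝ, rowSum R * x * colSum R = c • youngSymmetrizer R := by
  induction x using induction_single with
  | h1 g =>
    by_cases h : Transversal R R g
    · obtain ⟨p, q, hp, hq, rfl⟩ := h.exists_mul
      refine ⟨((Equiv.Perm.sign q : ℤ) : ℝ), ?_⟩
      rw [← one_mul (1 : ℝ), ← MonoidAlgebra.single_mul_single, ← mul_assoc, rowSum_mul_single hp,
        mul_assoc, single_mul_colSum hq, mul_smul_comm, youngSymmetrizer_eq]
    · exact ⟨0, by rw [rowSum_mul_single_mul_colSum_eq_zero h, zero_smul]⟩
  | h2 x y hx hy =>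
    obtain ⟨c, hc⟩ := hx
    obtain ⟨d, hd⟩ := hy
    exact ⟨c + d, by rw [mul_add, add_mul, hc, hd, add_smul]⟩
  | h3 c x hx =>
    obtain ⟨d, hd⟩ := hx
    exact ⟨c * d, by rw [mul_smul_comm, smul_mul_assoc, hd, mul_smul]⟩

theorem exists_youngSymmetrizer_mul_mul (R : n.Partition) (x : MonoidAlgebra ℝ (S n)) :
    ∃ c : ℝ, youngSymmetrizer R * x * youngSymmetrizer R = c • youngSymmetrizer R := by
  obtain ⟨c, hc⟩ := exists_rowSum_mul_mul_colSum R (colSum R * x * rowSum R)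
  refine ⟨c, hc ▸ ?_⟩
  simp only [youngSymmetrizer_eq, mul_assoc]

theorem coeff_one_youngSymmetrizer (R : n.Partition) :
    MonoidAlgebra.coeff (youngSymmetrizer R) 1 = 1 := by
  classical
  rw [youngSymmetrizer_eq, rowSum, colSum, Finset.sum_mul_sum, MonoidAlgebra.coeff_sum,
    Finset.sum_apply', Finset.sum_eq_single_of_mem 1 (by simp)]
  · rw [MonoidAlgebra.coeff_sum, Finset.sum_apply', Finset.sum_eq_single_of_mem 1 (by simp)]
    · simp [MonoidAlgebra.single_mul_single]
    · intro q _ hq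
      simp [MonoidAlgebra.single_mul_single, hq]
  · intro p hp hp1
    rw [MonoidAlgebra.coeff_sum, Finset.sum_apply']
    refine Finset.sum_eq_zero fun q hq => ?_
    rw [MonoidAlgebra.single_mul_single, MonoidAlgebra.coeff_single, Finsupp.single_eq_of_ne]
    -- If pq = 1, then p preserves both rows and columns, hence fixes every letter; only p = q = 1
    -- contributes to the coefficient of the identity.
    intro h
    apply hp1
    simp only [Finset.mem_filter, Finset.mem_univ, true_and] at hp hq
    ext i
    refine congrArg Fin.val (eq_of_rowOf_colOf R (hp i) ?_)
    rw [← hq (p i), Equiv.Perm.coe_one, id]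
    congr 1
    have : q * p = 1 := by rw [mul_eq_one_iff_eq_inv] at *; rw [eq_inv_of_mul_eq_one_left h.symm]; simp
    rw [← Equiv.Perm.mul_apply, this, Equiv.Perm.coe_one, id]

theorem youngSymmetrizer_ne_zero (R : n.Partition) : youngSymmetrizer R ≠ 0 := fun h => by
  have := coeff_one_youngSymmetrizer R
  simp [h] at this

theorem trace_mulRight (x : MonoidAlgebra ℝ (S n)) :
    LinearMap.trace ℝ _ (LinearMap.mulRight ℝ x) =
      Fintype.card (S n) * MonoidAlgebra.coeff x 1 := by
  rw [LinearMap.trace_eq_matrix_trace ℝ (MonoidAlgebra.basis (S n) ℝ), Matrix.trace]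
  simp [LinearMap.toMatrix_apply, MonoidAlgebra.basis, MonoidAlgebra.coeffLinearEquiv]

/-- If the scalar were zero, right multiplication by the symmetrizer would be nilpotent and have
trace 0; but its trace is n! times the coefficient of the identity, which is 1. -/
theorem exists_youngSymmetrizer_mul_self (R : n.Partition) :
    ∃ c : ℝ, c ≠ 0 ∧ youngSymmetrizer R * youngSymmetrizer R = c • youngSymmetrizer R := by
  obtain ⟨c, hc⟩ := exists_youngSymmetrizer_mul_mul R 1
  rw [mul_one] at hc
  refine ⟨c, ?_, hc⟩
  rintro rfl
  rw [zero_smul] at hc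
  have h1 : IsNilpotent (LinearMap.mulRight ℝ (youngSymmetrizer R)) :=
    ⟨2, by rw [LinearMap.pow_mulRight, pow_two, hc]; ext; simp⟩
  have h2 := (LinearMap.isNilpotent_trace_of_isNilpotent h1).eq_zero
  rw [trace_mulRight, coeff_one_youngSymmetrizer, mul_one, Nat.cast_eq_zero] at h2
  exact Fintype.card_ne_zero h2

end YoungSymmetrizer

/-! ### Schur's lemma for Specht modules over ℝ -/

section Schur

variable {n : ℕ}

/-- The Young symmetrizer as an element of the Specht module. -/
noncomputable def spechtGen (R : n.Partition) : specht R :=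
  ⟨youngSymmetrizer R, Ideal.subset_span rfl⟩

theorem spechtGen_ne_zero (R : n.Partition) : spechtGen R ≠ 0 := fun h =>
  youngSymmetrizer_ne_zero R (congrArg Subtype.val h)

theorem dim_pos (R : n.Partition) : 0 < dim R := by
  have : Nontrivial (specht R) := ⟨spechtGen R, 0, spechtGen_ne_zero R⟩
  have : Module.Finite ℝ (specht R) :=
    inferInstanceAs (Module.Finite ℝ ((specht R).restrictScalars ℝ))
  exact Module.finrank_pos

variable {R R' : n.Partition}

theorem intertwiner_map_mul {f : specht R →ₗ[ℝ] specht R'}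
    (hf : ∀ g v, f (spechtRep R g v) = spechtRep R' g (f v)) (x : MonoidAlgebra ℝ (S n))
    (v : specht R) : f (x • v) = x • f v := by
  induction x using induction_single with
  | h1 g => exact hf g v
  | h2 x y hx hy => rw [add_smul, map_add, hx, hy, add_smul]
  | h3 c x hx => rw [smul_assoc, map_smul, hx, smul_assoc]

theorem exists_smul_spechtGen (v : specht R) : ∃ x : MonoidAlgebra ℝ (S n), v = x • spechtGen R := by
  obtain ⟨x, hx⟩ := Ideal.mem_span_singleton'.1 v.2
  exact ⟨x, Subtype.ext hx.symm⟩

/-- The generator is a multiple of its own square, so its image is reproduced, up to a scalar, by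
left multiplication with the symmetrizer of R. The relations for symmetrizers then determine the
intertwiner without any appeal to irreducibility. -/
theorem intertwiner_spechtGen {f : specht R →ₗ[ℝ] specht R'}
    (hf : ∀ g v, f (spechtRep R g v) = spechtRep R' g (f v)) :
    ∃ (x : MonoidAlgebra ℝ (S n)), (f (spechtGen R) : MonoidAlgebra ℝ (S n)) =
      youngSymmetrizer R * x * youngSymmetrizer R' := by
  obtain ⟨c, hc, hcc⟩ := exists_youngSymmetrizer_mul_self R
  obtain ⟨x, hx⟩ := exists_smul_spechtGen (f (spechtGen R))
  refine ⟨c⁻¹ • x, ?_⟩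
  have h1 : spechtGen R = c⁻¹ • (youngSymmetrizer R • spechtGen R) :=
    Subtype.ext (by
      change youngSymmetrizer R = c⁻¹ • (youngSymmetrizer R * youngSymmetrizer R)
      rw [hcc, smul_smul, inv_mul_cancel₀ hc, one_smul])
  rw [h1, map_smul, intertwiner_map_mul hf, hx]
  change c⁻¹ • (youngSymmetrizer R * (x * youngSymmetrizer R')) = _
  rw [mul_smul_comm, smul_mul_assoc, mul_assoc]

theorem intertwiner_eq_zero (h : R ≠ R') {f : specht R →ₗ[ℝ] specht R'}
    (hf : ∀ g v, f (spechtRep R g v) = spechtRep R' g (f v)) : f = 0 := by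
  obtain ⟨x, hx⟩ := intertwiner_spechtGen hf
  rw [youngSymmetrizer_mul_mul_of_ne h] at hx
  ext1 v
  obtain ⟨y, rfl⟩ := exists_smul_spechtGen v
  rw [intertwiner_map_mul hf, Subtype.ext (a1 := f (spechtGen R)) (a2 := 0) hx, smul_zero,
    LinearMap.zero_apply]

theorem intertwiner_eq_smul_id {f : specht R →ₗ[ℝ] specht R}
    (hf : ∀ g v, f (spechtRep R g v) = spechtRep R g (f v)) :
    ∃ c : ℝ, f = c • LinearMap.id := by
  obtain ⟨x, hx⟩ := intertwiner_spechtGen hf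
  obtain ⟨c, hc⟩ := exists_youngSymmetrizer_mul_mul R x
  rw [hc] at hx
  refine ⟨c, ?_⟩
  ext1 v
  obtain ⟨y, rfl⟩ := exists_smul_spechtGen v
  rw [intertwiner_map_mul hf,
    Subtype.ext (a1 := f (spechtGen R)) (a2 := c • spechtGen R) hx, smul_comm]
  rfl

end Schur

/-! ### Orthogonal bases of the Specht modules -/

section OrthogonalForm

variable {n : ℕ}

/-- The coordinates of an element of `ℝ[S_n]` as a Euclidean vector. -/
noncomputable def toEuclidean (n : ℕ) : MonoidAlgebra ℝ (S n) ≃ₗ[ℝ] EuclideanSpace ℝ (S n) :=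
  (MonoidAlgebra.coeffLinearEquiv ℝ).trans
    ((Finsupp.linearEquivFunOnFinite ℝ ℝ (S n)).trans (WithLp.linearEquiv 2 ℝ (S n → ℝ)).symm)

theorem toEuclidean_apply (x : MonoidAlgebra ℝ (S n)) (σ : S n) :
    toEuclidean n x σ = MonoidAlgebra.coeff x σ := rfl

theorem inner_toEuclidean_single_mul (σ : S n) (x y : MonoidAlgebra ℝ (S n)) :
    inner ℝ (toEuclidean n x) (toEuclidean n (MonoidAlgebra.single σ 1 * y)) =
      inner ℝ (toEuclidean n (MonoidAlgebra.single σ⁻¹ 1 * x)) (toEuclidean n y) := by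
  simp only [PiLp.inner_apply, toEuclidean_apply, MonoidAlgebra.coeff_single_mul_apply, one_mul]
  refine Fintype.sum_equiv (Equiv.mulLeft σ⁻¹) _ _ fun g => ?_
  simp

/-- The Specht module as a subspace of Euclidean space. -/
noncomputable def euclideanSpecht (R : n.Partition) : Submodule ℝ (EuclideanSpace ℝ (S n)) :=
  ((specht R).restrictScalars ℝ).map (toEuclidean n).toLinearMap

/-- The Specht module is isomorphic to its image in Euclidean space. -/
noncomputable def spechtEquiv (R : n.Partition) : specht R ≃ₗ[ℝ] euclideanSpecht R :=
  (toEuclidean n).submoduleMap ((specht R).restrictScalars ℝ)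

theorem inner_spechtEquiv (R : n.Partition) (σ : S n) (v w : specht R) :
    inner ℝ (spechtEquiv R v) (spechtEquiv R (spechtRep R σ w)) =
      inner ℝ (spechtEquiv R (spechtRep R σ⁻¹ v)) (spechtEquiv R w) :=
  inner_toEuclidean_single_mul σ v w

/-- A basis of the Specht module that is orthonormal for the standard scalar product of
`ℝ[S_n]`. -/
noncomputable def spechtONB (R : n.Partition) :
    OrthonormalBasis (Fin (dim R)) ℝ (euclideanSpecht R) :=
  (stdOrthonormalBasis ℝ (euclideanSpecht R)).reindex
    (finCongr (spechtEquiv R).finrank_eq.symm)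

/-- Left multiplication by a permutation permutes the coordinates of ℝ[S_n], so it preserves the
standard scalar product; an orthonormal basis of the Specht module for this product serves. -/
theorem nonempty_orthogonalBases (n : ℕ) : Nonempty (OrthogonalBases n) := by
  let b (R : n.Partition) : Module.Basis (Fin (dim R)) ℝ (specht R) :=
    (spechtONB R).toBasis.map (spechtEquiv R).symm
  have hb (R : n.Partition) (i j : Fin (dim R)) (σ : S n) :
      LinearMap.toMatrix (b R) (b R) (spechtRep R σ) i j =
        inner ℝ (spechtEquiv R (b R i)) (spechtEquiv R (spechtRep R σ (b R j))) := by
    rw [LinearMap.toMatrix_apply]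
    simp [b, OrthonormalBasis.repr_apply_apply]
  refine ⟨⟨b, fun R σ => ?_⟩⟩
  rw [Matrix.mem_orthogonalGroup_iff]
  have h1 : (LinearMap.toMatrix (b R) (b R) (spechtRep R σ)).transpose =
      LinearMap.toMatrix (b R) (b R) (spechtRep R σ⁻¹) := by
    ext i j
    rw [Matrix.transpose_apply, hb, hb, inner_spechtEquiv, real_inner_comm]
  rw [h1, ← LinearMap.toMatrix_mul, ← map_mul, mul_inv_cancel, map_one, LinearMap.toMatrix_one]

end OrthogonalForm

/-! ### Matrix entries and Schur orthogonality -/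

namespace OrthogonalBases

variable {n : ℕ} (B : OrthogonalBases n)

theorem D_mul (R : n.Partition) (σ τ : S n) : B.D R (σ * τ) = B.D R σ * B.D R τ := by
  rw [D, map_mul, LinearMap.toMatrix_mul]; rfl

theorem D_one (R : n.Partition) : B.D R 1 = 1 := by
  rw [D, map_one, LinearMap.toMatrix_one]

theorem D_inv (R : n.Partition) (σ : S n) : B.D R σ⁻¹ = (B.D R σ).transpose := by
  have h1 : B.D R σ⁻¹ * B.D R σ = 1 := by rw [← D_mul, inv_mul_cancel, D_one]
  have h2 : B.D R σ * (B.D R σ).transpose = 1 :=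
    (Matrix.mem_orthogonalGroup_iff _ _).1 (B.orthogonal R σ)
  exact left_inv_eq_right_inv h1 h2

theorem D_inv_apply (R : n.Partition) (σ : S n) (i j : Fin (dim R)) :
    B.D R σ⁻¹ i j = B.D R σ j i := by rw [D_inv, Matrix.transpose_apply]

theorem trace_D (R : n.Partition) (σ : S n) : (B.D R σ).trace = chi R σ := by
  rw [chi, LinearMap.trace_eq_matrix_trace ℝ (B.basis R)]; rfl

theorem schur_aux {R R' : n.Partition} {M : Matrix (Fin (dim R')) (Fin (dim R)) ℝ}
    (h : ∀ σ, M * B.D R σ = B.D R' σ * M) (g : S n) (v : specht R) :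
    Matrix.toLin (B.basis R) (B.basis R') M (spechtRep R g v) =
      spechtRep R' g (Matrix.toLin (B.basis R) (B.basis R') M v) := by
  have h1 := congrArg (Matrix.toLin (B.basis R) (B.basis R')) (h g)
  rw [Matrix.toLin_mul _ (B.basis R), Matrix.toLin_mul _ (B.basis R'), D, D,
    Matrix.toLin_toMatrix, Matrix.toLin_toMatrix] at h1
  exact LinearMap.congr_fun h1 v

theorem schur_of_ne {R R' : n.Partition} (hR : R ≠ R') {M : Matrix (Fin (dim R')) (Fin (dim R)) ℝ}
    (h : ∀ σ, M * B.D R σ = B.D R' σ * M) : M = 0 :=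
  (Matrix.toLin (B.basis R) (B.basis R')).map_eq_zero_iff.1
    (intertwiner_eq_zero hR (B.schur_aux h))

theorem schur_self {R : n.Partition} {M : Matrix (Fin (dim R)) (Fin (dim R)) ℝ}
    (h : ∀ σ, M * B.D R σ = B.D R σ * M) : ∃ c : ℝ, M = c • 1 := by
  obtain ⟨c, hc⟩ := intertwiner_eq_smul_id (B.schur_aux h)
  refine ⟨c, ?_⟩
  rw [← LinearMap.toMatrix_toLin (B.basis R) (B.basis R) M, hc, map_smul, LinearMap.toMatrix_id]

/-- The average of a matrix over the group. -/
noncomputable def average (R R' : n.Partition) (X : Matrix (Fin (dim R')) (Fin (dim R)) ℝ) :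
    Matrix (Fin (dim R')) (Fin (dim R)) ℝ :=
  ∑ σ, B.D R' σ * X * B.D R σ⁻¹

theorem average_mul (R R' : n.Partition) (X : Matrix (Fin (dim R')) (Fin (dim R)) ℝ) (τ : S n) :
    B.average R R' X * B.D R τ = B.D R' τ * B.average R R' X := by
  rw [average, Matrix.sum_mul, Matrix.mul_sum]
  refine Fintype.sum_equiv (Equiv.mulLeft τ⁻¹) _ _ fun σ => ?_
  have h1 : B.D R' τ * B.D R' (τ⁻¹ * σ) = B.D R' σ := by rw [← D_mul, mul_inv_cancel_left]
  rw [Equiv.coe_mulLeft, mul_inv_rev, inv_inv, D_mul B R, ← h1]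
  simp only [Matrix.mul_assoc]

/-- Averaging an elementary matrix isolates a product of two matrix entries; orthogonality of D
turns the inverse into a transpose. Schur's lemma for averages thus becomes a statement about sums
of products of entries. -/
theorem average_single (R R' : n.Partition) (i j : Fin (dim R')) (k l : Fin (dim R)) :
    B.average R R' (Matrix.single j l 1) i k = ∑ σ, B.D R' σ i j * B.D R σ k l := by
  rw [average, Matrix.sum_apply]
  refine Finset.sum_congr rfl fun σ _ => ?_
  rw [Matrix.mul_assoc, Matrix.mul_apply, Finset.sum_eq_single j]
  · simp [D_inv_apply]
  · intro m _ hm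
    rw [Matrix.single_mul_apply_of_ne _ _ _ _ _ hm, mul_zero]
  · simp

theorem sum_D_mul_D_of_ne {R R' : n.Partition} (h : R ≠ R') (i j : Fin (dim R))
    (k l : Fin (dim R')) : ∑ σ, B.D R σ i j * B.D R' σ k l = 0 := by
  rw [← average_single, B.schur_of_ne h.symm (B.average_mul _ _ _), Matrix.zero_apply]

theorem dim_ne_zero (R : n.Partition) : (dim R : ℝ) ≠ 0 := Nat.cast_ne_zero.2 (dim_pos R).ne'

theorem sum_D_mul_D (R : n.Partition) (i j k l : Fin (dim R)) :
    ∑ σ, B.D R σ i j * B.D R σ k l =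
      if i = k ∧ j = l then (n.factorial : ℝ) / dim R else 0 := by
  obtain ⟨c, hc⟩ := B.schur_self (B.average_mul R R (Matrix.single j l 1))
  -- The trace fixes the Schur scalar: conjugation preserves it, so the average has trace n! δ_{jl},
  -- while the scalar matrix has trace c d(R).
  have h1 : (B.average R R (Matrix.single j l 1)).trace =
      n.factorial * (if j = l then 1 else 0) := by
    have h2 : ∀ σ, (B.D R σ * Matrix.single j l 1 * B.D R σ⁻¹).trace = if j = l then 1 else 0 := by
      intro σ
      rw [Matrix.trace_mul_comm, ← Matrix.mul_assoc, ← D_mul, inv_mul_cancel, D_one,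
        Matrix.one_mul]
      split_ifs with h
      · subst h; simp
      · rw [Matrix.trace_single_eq_of_ne _ _ _ h]
    simp only [average, Matrix.trace_sum, h2, Finset.sum_const, nsmul_eq_mul, Finset.card_univ,
      Fintype.card_perm, Fintype.card_fin]
  have h2 := h1
  rw [hc, Matrix.trace_smul, Matrix.trace_one, Fintype.card_fin, smul_eq_mul,
    ← eq_div_iff (dim_ne_zero R)] at h2
  rw [← average_single, hc, h2, Matrix.smul_apply, Matrix.one_apply]
  by_cases h : i = k <;> by_cases h' : j = l <;> simp [h, h']

theorem sum_chi_mul_chi (R R' : n.Partition) :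
    ∑ σ, chi R σ * chi R' σ = if R = R' then (n.factorial : ℝ) else 0 := by
  obtain ⟨B⟩ := nonempty_orthogonalBases n
  simp only [← B.trace_D, Matrix.trace, Matrix.diag, Finset.sum_mul_sum]
  rw [Finset.sum_comm, Finset.sum_congr rfl fun i _ => Finset.sum_comm]
  split_ifs with h
  · subst h
    simp only [sum_D_mul_D, and_self]
    simp [mul_div_cancel₀ _ (dim_ne_zero R)]
  · simp [B.sum_D_mul_D_of_ne h]

end OrthogonalBases

/-! ### Completeness of the irreducible characters -/

section Completeness

variable {n : ℕ}

theorem chi_conj (R : n.Partition) (σ τ : S n) : chi R (τ * σ * τ⁻¹) = chi R σ := by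
  obtain ⟨B⟩ := nonempty_orthogonalBases n
  rw [← B.trace_D, ← B.trace_D, B.D_mul, Matrix.trace_mul_comm, ← B.D_mul]
  congr 2
  group

theorem chi_one (R : n.Partition) : chi R 1 = dim R := by
  obtain ⟨B⟩ := nonempty_orthogonalBases n
  rw [← B.trace_D, B.D_one, Matrix.trace_one, Fintype.card_fin]

theorem chi_inv (R : n.Partition) (σ : S n) : chi R σ⁻¹ = chi R σ := by
  obtain ⟨B⟩ := nonempty_orthogonalBases n
  rw [← B.trace_D, ← B.trace_D, B.D_inv, Matrix.trace_transpose]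

/-- The character as a function of the cycle type. -/
noncomputable def chiCycleType (R : n.Partition) : (Fintype.card (Fin n)).Partition → ℝ :=
  Function.extend (fun σ : S n => σ.partition) (chi R) 0

theorem chiCycleType_partition (R : n.Partition) (σ : S n) :
    chiCycleType R σ.partition = chi R σ := by
  refine Function.FactorsThrough.extend_apply (f := fun σ : S n => σ.partition) ?_ _ σ
  intro σ τ h
  obtain ⟨g, hg⟩ := isConj_iff.1 (Equiv.Perm.partition_eq_of_isConj.2 h)
  rw [← hg, chi_conj]

theorem linearIndependent_chiCycleType :
    LinearIndependent ℝ (chiCycleType : n.Partition → _) := by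
  rw [Fintype.linearIndependent_iff]
  intro c hc R
  have h1 : ∀ σ : S n, ∑ R, c R * chi R σ = 0 := fun σ => by
    simpa [chiCycleType_partition] using congrFun hc σ.partition
  have h2 : ∑ σ, (∑ R', c R' * chi R' σ) * chi R σ = c R * n.factorial := by
    simp only [Finset.sum_mul, mul_assoc]
    rw [Finset.sum_comm]
    simp [← Finset.mul_sum, OrthogonalBases.sum_chi_mul_chi]
  simp only [h1, zero_mul, Finset.sum_const_zero] at h2
  exact (mul_eq_zero.1 h2.symm).resolve_right (Nat.cast_ne_zero.2 n.factorial_ne_zero)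

/-- The characters are independent class functions, as many as there are cycle types, so they span
and the indicator of the identity is a combination of them. Orthogonality identifies its
coefficients as d(R)/n!. This replaces a proof that every irreducible representation is a Specht
module. -/
theorem sum_dim_mul_chi (σ : S n) :
    ∑ R, (dim R : ℝ) * chi R σ = if σ = 1 then (n.factorial : ℝ) else 0 := by
  have hcard : Fintype.card n.Partition =
      Module.finrank ℝ ((Fintype.card (Fin n)).Partition → ℝ) := by
    rw [Module.finrank_fintype_fun_eq_card, Fintype.card_fin n]
  have hspan := linearIndependent_chiCycleType.span_eq_top_of_card_eq_finrank' hcard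
  obtain ⟨c, hc⟩ := (Submodule.mem_span_range_iff_exists_fun ℝ).1
    (hspan ▸ Submodule.mem_top (x := Pi.single (1 : S n).partition (1 : ℝ)))
  have h1 : ∀ τ : S n, ∑ R, c R * chi R τ = if τ = 1 then 1 else 0 := fun τ => by
    have := congrFun hc τ.partition
    simp only [Finset.sum_apply, Pi.smul_apply, chiCycleType_partition, smul_eq_mul] at this
    rw [this, Pi.single_apply]
    refine if_congr ?_ rfl rfl
    rw [← Equiv.Perm.partition_eq_of_isConj, isConj_one_left]
  have h2 : ∀ R, c R * n.factorial = dim R := fun R => by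
    have h3 : ∑ τ, (∑ R', c R' * chi R' τ) * chi R τ = c R * n.factorial := by
      simp only [Finset.sum_mul, mul_assoc]
      rw [Finset.sum_comm]
      simp [← Finset.mul_sum, OrthogonalBases.sum_chi_mul_chi]
    rw [← h3, ← chi_one]
    simp [h1]
  simp only [← h2, mul_right_comm _ (n.factorial : ℝ), ← Finset.sum_mul, h1]
  split_ifs <;> simp

end Completeness

/-! ### Matrix units in an algebra carrying a representation of S_n -/

namespace OrthogonalBases

section MatrixUnits

variable {n : ℕ} (B : OrthogonalBases n) {X : Type*} [Ring X] [Algebra ℝ X] (ρ : S n →* X)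

/-- The matrix units `(d(R)/n!) ∑_σ D^R_{ij}(σ) ρ(σ)` in an algebra on which `S_n` is represented
by `ρ`. -/
noncomputable def matUnit (R : n.Partition) (i j : Fin (dim R)) : X :=
  ((dim R : ℝ) / n.factorial) • ∑ σ, B.D R σ i j • ρ σ

theorem factorial_ne_zero_real (n : ℕ) : (n.factorial : ℝ) ≠ 0 := Nat.cast_ne_zero.2 n.factorial_ne_zero

theorem chi_eq_sum (R : n.Partition) (σ : S n) : chi R σ = ∑ i, B.D R σ i i :=
  (B.trace_D R σ).symm

theorem mul_matUnit (R : n.Partition) (i j : Fin (dim R)) (τ : S n) :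
    ρ τ * B.matUnit ρ R i j = ∑ k, B.D R τ k i • B.matUnit ρ R k j := by
  simp only [matUnit, mul_smul_comm, Finset.mul_sum, Finset.smul_sum, ← map_mul]
  rw [Finset.sum_comm]
  refine Fintype.sum_equiv (Equiv.mulLeft τ) _ _ fun σ => ?_
  simp only [smul_smul, ← Finset.sum_smul, Equiv.coe_mulLeft]
  congr 1
  have h1 : B.D R σ i j = ∑ k, B.D R τ k i * B.D R (τ * σ) k j := by
    conv_lhs => rw [← inv_mul_cancel_left τ σ, D_mul, Matrix.mul_apply]
    simp only [D_inv_apply]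
  rw [h1, Finset.mul_sum]
  exact Finset.sum_congr rfl fun k _ => by ring

theorem matUnit_mul (R : n.Partition) (i j : Fin (dim R)) (τ : S n) :
    B.matUnit ρ R i j * ρ τ = ∑ k, B.D R τ j k • B.matUnit ρ R i k := by
  simp only [matUnit, smul_mul_assoc, Finset.sum_mul, Finset.smul_sum, ← map_mul]
  rw [Finset.sum_comm]
  refine Fintype.sum_equiv (Equiv.mulRight τ) _ _ fun σ => ?_
  simp only [smul_smul, ← Finset.sum_smul, Equiv.coe_mulRight]
  congr 1
  have h1 : B.D R σ i j = ∑ k, B.D R (σ * τ) i k * B.D R τ j k := by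
    conv_lhs => rw [← mul_inv_cancel_right σ τ, D_mul, Matrix.mul_apply]
    simp only [D_inv_apply]
  rw [h1, Finset.mul_sum]
  exact Finset.sum_congr rfl fun k _ => by ring

/-- Expanding only the first factor and letting its permutations act on the second by `mul_matUnit`
leaves a sum of products of two matrix entries, evaluated by Schur orthogonality. -/
theorem matUnit_mul_matUnit (R : n.Partition) (i j k l : Fin (dim R)) :
    B.matUnit ρ R i j * B.matUnit ρ R k l = if j = k then B.matUnit ρ R i l else 0 := by
  conv_lhs => rw [matUnit]
  simp only [smul_mul_assoc, Finset.sum_mul, mul_matUnit, Finset.smul_sum, smul_smul]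
  rw [Finset.sum_comm]
  simp only [← Finset.sum_smul, mul_assoc, ← Finset.mul_sum, sum_D_mul_D]
  split_ifs with h
  · have h1 : (dim R : ℝ) / n.factorial * (n.factorial / dim R) = 1 := by
      have := dim_ne_zero R
      have := factorial_ne_zero_real n
      field_simp
    simp [h, h1]
  · simp [h]

theorem matUnit_mul_matUnit_of_ne {R R' : n.Partition} (h : R ≠ R') (i j : Fin (dim R))
    (k l : Fin (dim R')) : B.matUnit ρ R i j * B.matUnit ρ R' k l = 0 := by
  conv_lhs => rw [matUnit]
  simp only [smul_mul_assoc, Finset.sum_mul, mul_matUnit, Finset.smul_sum, smul_smul]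
  rw [Finset.sum_comm]
  simp only [← Finset.sum_smul, mul_assoc, ← Finset.mul_sum, B.sum_D_mul_D_of_ne h, mul_zero, zero_smul,
    Finset.sum_const_zero]

theorem sum_matUnit_self (R : n.Partition) :
    ∑ i, B.matUnit ρ R i i = ((dim R : ℝ) / n.factorial) • ∑ σ, chi R σ • ρ σ := by
  simp only [matUnit, ← Finset.smul_sum]
  rw [Finset.sum_comm]
  simp only [← Finset.sum_smul, ← chi_eq_sum]

theorem sum_sum_matUnit_self : ∑ R, ∑ i, B.matUnit ρ R i i = 1 := by
  simp only [sum_matUnit_self, Finset.smul_sum, smul_smul]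
  rw [Finset.sum_comm]
  simp only [← Finset.sum_smul, div_mul_eq_mul_div, ← Finset.sum_div, sum_dim_mul_chi]
  rw [Finset.sum_eq_single 1]
  · rw [if_pos rfl, div_self (factorial_ne_zero_real n), one_smul, map_one]
  · intro σ _ h
    rw [if_neg h, zero_div, zero_smul]
  · simp

end MatrixUnits

end OrthogonalBases

/-! ### Existence of Clebsch–Gordan coefficients -/

section ClebschGordan

variable {n : ℕ} (B : OrthogonalBases n)

/-- An idempotent symmetric matrix is `V Vᵀ` with orthonormal columns in `V`. -/
theorem exists_orthonormal_factorization {κ : Type*} [Fintype κ] [DecidableEq κ]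
    (T : Matrix κ κ ℝ) (hT : T.transpose = T) (hTT : T * T = T) :
    ∃ (m : ℕ) (V : Matrix κ (Fin m) ℝ), V * V.transpose = T ∧ V.transpose * V = 1 := by
  let f : EuclideanSpace ℝ κ →ₗ[ℝ] EuclideanSpace ℝ κ := Matrix.toEuclideanLin T
  let b := stdOrthonormalBasis ℝ f.range
  have hfix : ∀ i, T.mulVec (b i : EuclideanSpace ℝ κ).ofLp = (b i : EuclideanSpace ℝ κ).ofLp := by
    intro i
    obtain ⟨w, hw⟩ := (b i).2
    rw [← hw]
    change T.mulVec (T.mulVec w.ofLp) = T.mulVec w.ofLp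
    rw [Matrix.mulVec_mulVec, hTT]
  let V : Matrix κ (Fin (Module.finrank ℝ f.range)) ℝ := fun k i => (b i : EuclideanSpace ℝ κ) k
  have hVV : V.transpose * V = 1 := by
    ext i j
    have := b.inner_eq_ite i j
    rw [Submodule.coe_inner, PiLp.inner_apply] at this
    rw [Matrix.mul_apply, Matrix.one_apply, ← this]
    refine Finset.sum_congr rfl fun k _ => ?_
    rw [RCLike.inner_apply, conj_trivial]
    exact mul_comm _ _
  have hTV : T * V = V := by
    ext k i
    exact congrFun (hfix i) k
  have hVT : V * V.transpose * T = T := by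
    ext k l
    let w : EuclideanSpace ℝ κ := f (EuclideanSpace.single l 1)
    have hw : ∀ k, w k = T k l := fun k => by
      change T.mulVec (Pi.single l 1) k = T k l
      simp
    have h1 := congrArg (fun x : f.range => (x : EuclideanSpace ℝ κ) k)
      (b.sum_repr' ⟨w, LinearMap.mem_range_self _ _⟩)
    simp only [Submodule.coe_sum, Submodule.coe_smul, Submodule.coe_inner, PiLp.inner_apply,
      WithLp.ofLp_sum, Finset.sum_apply, WithLp.ofLp_smul, Pi.smul_apply, hw] at h1
    rw [Matrix.mul_assoc, Matrix.mul_apply, ← h1]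
    refine Finset.sum_congr rfl fun i _ => ?_
    rw [Matrix.mul_apply, smul_eq_mul, mul_comm]
    congr 1
    refine Finset.sum_congr rfl fun k _ => ?_
    rw [RCLike.inner_apply, conj_trivial]
    exact mul_comm _ _
  -- Transposing V Vᵀ T = T gives T V Vᵀ = T, and T V = V reduces the left side to V Vᵀ.
  refine ⟨_, V, ?_, hVV⟩
  have h2 := congrArg Matrix.transpose hVT
  rw [Matrix.transpose_mul, Matrix.transpose_mul, Matrix.transpose_transpose, hT,
    ← Matrix.mul_assoc, hTV] at h2
  exact h2

/-- The matrices of the tensor product of two irreducible representations. -/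
noncomputable def tensorRep (R₁ R₂ : n.Partition) :
    S n →* Matrix (Fin (dim R₁) × Fin (dim R₂)) (Fin (dim R₁) × Fin (dim R₂)) ℝ where
  toFun σ := Matrix.kroneckerMap (· * ·) (B.D R₁ σ) (B.D R₂ σ)
  map_one' := by rw [B.D_one, B.D_one]; exact Matrix.one_kronecker_one
  map_mul' σ τ := by rw [B.D_mul, B.D_mul]; exact Matrix.mul_kronecker_mul _ _ _ _

theorem tensorRep_apply (R₁ R₂ : n.Partition) (σ : S n) (i j : Fin (dim R₁) × Fin (dim R₂)) :
    tensorRep B R₁ R₂ σ i j = B.D R₁ σ i.1 j.1 * B.D R₂ σ i.2 j.2 := rfl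

theorem transpose_tensorRep (R₁ R₂ : n.Partition) (σ : S n) :
    (tensorRep B R₁ R₂ σ).transpose = tensorRep B R₁ R₂ σ⁻¹ := by
  ext i j
  rw [Matrix.transpose_apply, tensorRep_apply, tensorRep_apply, B.D_inv_apply, B.D_inv_apply]

theorem transpose_matUnit (R₁ R₂ R : n.Partition) (i j : Fin (dim R)) :
    (B.matUnit (tensorRep B R₁ R₂) R i j).transpose = B.matUnit (tensorRep B R₁ R₂) R j i := by
  rw [OrthogonalBases.matUnit, OrthogonalBases.matUnit, Matrix.transpose_smul,
    Matrix.transpose_sum]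
  congr 1
  refine Fintype.sum_equiv (Equiv.inv _) _ _ fun σ => ?_
  rw [Matrix.transpose_smul, transpose_tensorRep, Equiv.inv_apply, B.D_inv_apply]

/-- In V_{R₁} ⊗ V_{R₂} the matrix unit T_{oo}, for a base index o, is an orthogonal projection, and
an orthonormal basis of its range labels the copies τ of V_R. Transporting it by T_{io} gives the
vectors |R,τ,i⟩. Intertwining and orthonormality are relations of matrix units; completeness is that
the diagonal ones sum to 1. -/
theorem nonempty_clebschGordan : Nonempty (ClebschGordan B) := by
  classical
  let T (R₁ R₂ R : n.Partition) := B.matUnit (tensorRep B R₁ R₂) R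
  let o (R : n.Partition) : Fin (dim R) := ⟨0, dim_pos R⟩
  have hTt : ∀ R₁ R₂ R i j, (T R₁ R₂ R i j).transpose = T R₁ R₂ R j i := fun R₁ R₂ R i j =>
    transpose_matUnit B R₁ R₂ R i j
  have hTT : ∀ R₁ R₂ R i j k, T R₁ R₂ R i j * T R₁ R₂ R j k = T R₁ R₂ R i k :=
    fun R₁ R₂ R i j k => by simp only [T, B.matUnit_mul_matUnit, if_pos]
  choose m V hV hV' using fun R₁ R₂ R => exists_orthonormal_factorization
    (T R₁ R₂ R (o R) (o R)) (hTt _ _ _ _ _) (hTT _ _ _ _ _ _)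
  let W (R₁ R₂ R : n.Partition) (i : Fin (dim R)) := T R₁ R₂ R i (o R) * V R₁ R₂ R
  have hVT : ∀ R₁ R₂ R, (V R₁ R₂ R).transpose * T R₁ R₂ R (o R) (o R) = (V R₁ R₂ R).transpose :=
    fun R₁ R₂ R => by rw [← hV, ← Matrix.mul_assoc, hV', Matrix.one_mul]
  have hWW : ∀ R₁ R₂ R i j, (W R₁ R₂ R i).transpose * W R₁ R₂ R j = if i = j then 1 else 0 := by
    intro R₁ R₂ R i j
    simp only [W]
    rw [Matrix.transpose_mul, hTt, Matrix.mul_assoc, ← Matrix.mul_assoc (T _ _ _ _ _)]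
    simp only [T, B.matUnit_mul_matUnit]
    split_ifs with h
    · rw [← Matrix.mul_assoc, hVT, hV']
    · simp
  have hWW' : ∀ R₁ R₂ R R', R ≠ R' → ∀ i j, (W R₁ R₂ R i).transpose * W R₁ R₂ R' j = 0 := by
    intro R₁ R₂ R R' h i j
    simp only [W]
    rw [Matrix.transpose_mul, hTt, Matrix.mul_assoc, ← Matrix.mul_assoc (T _ _ _ _ _)]
    simp only [T, B.matUnit_mul_matUnit_of_ne _ h]
    simp
  refine ⟨⟨m, fun R₁ R₂ R τ i₁ i₂ i₃ => W R₁ R₂ R i₃ (i₁, i₂) τ, ?_, ?_, ?_⟩⟩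
  · intro R₁ R₂ R τ γ i₁ i₂ j
    have h1 : tensorRep B R₁ R₂ γ * W R₁ R₂ R j = ∑ k, B.D R γ k j • W R₁ R₂ R k := by
      simp only [W]
      rw [← Matrix.mul_assoc, B.mul_matUnit, Matrix.sum_mul]
      simp only [Matrix.smul_mul, T]
    have h2 := congrFun (congrFun h1 (i₁, i₂)) τ
    rw [Matrix.mul_apply, Fintype.sum_prod_type, Matrix.sum_apply] at h2
    refine h2.trans (Finset.sum_congr rfl fun k _ => mul_comm _ _)
  · rintro R₁ R₂ ⟨R, τ, i⟩ ⟨R', τ', i'⟩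
    have h0 : ∑ i₁, ∑ i₂, W R₁ R₂ R i (i₁, i₂) τ * W R₁ R₂ R' i' (i₁, i₂) τ' =
        ((W R₁ R₂ R i).transpose * W R₁ R₂ R' i') τ τ' := by
      rw [Matrix.mul_apply, Fintype.sum_prod_type]; rfl
    refine h0.trans ?_
    by_cases h : R = R'
    · subst h
      rw [hWW]
      by_cases h1 : i = i' <;> by_cases h2 : τ = τ' <;> simp [h1, h2, Matrix.one_apply]
    · rw [hWW' _ _ _ _ h]
      simp [h]
  · intro R₁ R₂ i₁ j₁ i₂ j₂
    have h1 := congrFun (congrFun (B.sum_sum_matUnit_self (tensorRep B R₁ R₂)) (i₁, i₂)) (j₁, j₂)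
    rw [Matrix.one_apply, Matrix.sum_apply] at h1
    simp only [Prod.mk.injEq] at h1
    rw [← h1]
    refine Finset.sum_congr rfl fun R _ => ?_
    rw [Finset.sum_comm, Matrix.sum_apply]
    refine Finset.sum_congr rfl fun i _ => ?_
    have h2 : W R₁ R₂ R i * (W R₁ R₂ R i).transpose = T R₁ R₂ R i i := by
      simp only [W]
      rw [Matrix.transpose_mul, hTt, Matrix.mul_assoc, ← Matrix.mul_assoc (V _ _ _), hV,
        hTT, hTT]
    exact congrFun (congrFun h2 (i₁, i₂)) (j₁, j₂)

end ClebschGordan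

/-! ### Multiplicities and Kronecker coefficients -/

namespace ClebschGordan

variable {n : ℕ} {B : OrthogonalBases n} (cg : ClebschGordan B)

/-- The Clebsch-Gordan coefficients for a copy of `V_{R₃}` as a matrix. -/
noncomputable def mat (R₁ R₂ R₃ : n.Partition) (τ : Fin (cg.mult R₁ R₂ R₃)) :
    Matrix (Fin (dim R₁) × Fin (dim R₂)) (Fin (dim R₃)) ℝ :=
  Matrix.of fun x i => cg.coeff R₁ R₂ R₃ τ x.1 x.2 i

theorem mat_apply (R₁ R₂ R₃ : n.Partition) (τ : Fin (cg.mult R₁ R₂ R₃))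
    (x : Fin (dim R₁) × Fin (dim R₂)) (i : Fin (dim R₃)) :
    cg.mat R₁ R₂ R₃ τ x i = cg.coeff R₁ R₂ R₃ τ x.1 x.2 i := rfl

theorem tensorRep_mul_mat (R₁ R₂ R₃ : n.Partition) (τ : Fin (cg.mult R₁ R₂ R₃)) (γ : S n) :
    tensorRep B R₁ R₂ γ * cg.mat R₁ R₂ R₃ τ = cg.mat R₁ R₂ R₃ τ * B.D R₃ γ := by
  ext x j
  rw [Matrix.mul_apply, Matrix.mul_apply, Fintype.sum_prod_type]
  exact cg.intertwines R₁ R₂ R₃ τ γ x.1 x.2 j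

theorem transpose_mat_mul_mat (R₁ R₂ R₃ : n.Partition) (τ : Fin (cg.mult R₁ R₂ R₃)) :
    (cg.mat R₁ R₂ R₃ τ).transpose * cg.mat R₁ R₂ R₃ τ = 1 := by
  ext i j
  rw [Matrix.mul_apply, Fintype.sum_prod_type, Matrix.one_apply]
  refine (cg.orthonormal R₁ R₂ ⟨R₃, τ, i⟩ ⟨R₃, τ, j⟩).trans ?_
  by_cases h : i = j <;> simp [h]

theorem sum_mat_mul_transpose_mat (R₁ R₂ : n.Partition) :
    ∑ R₃, ∑ τ, cg.mat R₁ R₂ R₃ τ * (cg.mat R₁ R₂ R₃ τ).transpose = 1 := by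
  ext x y
  rw [Matrix.one_apply, Matrix.sum_apply]
  simp only [Matrix.sum_apply, Matrix.mul_apply, Matrix.transpose_apply, mat_apply]
  refine (cg.complete R₁ R₂ x.1 y.1 x.2 y.2).trans (if_congr ?_ rfl rfl)
  rw [Prod.ext_iff]

theorem tensorRep_eq (R₁ R₂ : n.Partition) (γ : S n) :
    tensorRep B R₁ R₂ γ =
      ∑ R₃, ∑ τ, cg.mat R₁ R₂ R₃ τ * B.D R₃ γ * (cg.mat R₁ R₂ R₃ τ).transpose := by
  rw [← mul_one (tensorRep B R₁ R₂ γ), ← cg.sum_mat_mul_transpose_mat R₁ R₂]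
  simp only [Finset.mul_sum, ← Matrix.mul_assoc, tensorRep_mul_mat]

theorem trace_tensorRep (R₁ R₂ : n.Partition) (γ : S n) :
    (tensorRep B R₁ R₂ γ).trace = chi R₁ γ * chi R₂ γ := by
  rw [← B.trace_D, ← B.trace_D]
  exact Matrix.trace_kronecker _ _

theorem chi_mul_chi (R₁ R₂ : n.Partition) (γ : S n) :
    chi R₁ γ * chi R₂ γ = ∑ R₃, cg.mult R₁ R₂ R₃ * chi R₃ γ := by
  rw [← trace_tensorRep (B := B), cg.tensorRep_eq, Matrix.trace_sum]
  refine Finset.sum_congr rfl fun R₃ _ => ?_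
  rw [Matrix.trace_sum, Finset.sum_congr rfl fun τ _ => show _ = chi R₃ γ from ?_]
  · simp
  · rw [Matrix.trace_mul_comm, ← Matrix.mul_assoc, transpose_mat_mul_mat, Matrix.one_mul, B.trace_D]

/-- The trace of the Clebsch–Gordan decomposition expands χ^{R₁} χ^{R₂} in irreducible characters;
orthogonality extracts the multiplicity. Thus `mult` is the same for every choice of coefficients.
-/
theorem kronecker_eq_mult (R₁ R₂ R₃ : n.Partition) :
    kronecker R₁ R₂ R₃ = cg.mult R₁ R₂ R₃ := by
  have h1 : ∀ σ, chi R₁ σ * chi R₂ σ * chi R₃ σ =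
      ∑ R, cg.mult R₁ R₂ R * (chi R σ * chi R₃ σ) := fun σ => by
    rw [cg.chi_mul_chi, Finset.sum_mul]
    simp only [mul_assoc]
  simp only [kronecker, h1]
  rw [Finset.sum_comm]
  simp only [← Finset.mul_sum, OrthogonalBases.sum_chi_mul_chi]
  have := OrthogonalBases.factorial_ne_zero_real n
  simp
  field_simp

theorem sum_mat_mul_tensorRep (R₁ R₂ R₃ : n.Partition) (τ : Fin (cg.mult R₁ R₂ R₃)) (γ : S n)
    (i j : Fin (dim R₃)) :
    ∑ x, ∑ y, cg.mat R₁ R₂ R₃ τ x i * cg.mat R₁ R₂ R₃ τ y j * tensorRep B R₁ R₂ γ x y =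
      B.D R₃ γ i j := by
  have h1 : (cg.mat R₁ R₂ R₃ τ).transpose * (tensorRep B R₁ R₂ γ * cg.mat R₁ R₂ R₃ τ) =
      B.D R₃ γ := by
    rw [tensorRep_mul_mat, ← Matrix.mul_assoc, transpose_mat_mul_mat, Matrix.one_mul]
  rw [← h1, Matrix.mul_apply]
  refine Finset.sum_congr rfl fun x _ => ?_
  rw [Matrix.mul_apply, Finset.mul_sum]
  refine Finset.sum_congr rfl fun y _ => ?_
  rw [Matrix.transpose_apply]
  ring

end ClebschGordan

/-! ### The complex group algebra and its pairings -/

section GroupAlgebra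

variable {n : ℕ}

theorem el_mul_el (σ τ : S n) : el σ * el τ = el (σ * τ) := by
  have := MonoidAlgebra.single_mul_single (R := ℂ) σ τ 1 1
  rw [one_mul] at this
  exact this

/-- The inclusion of the symmetric group into its group algebra. -/
noncomputable def elHom (n : ℕ) : S n →* A n where
  toFun := el
  map_one' := rfl
  map_mul' σ τ := (el_mul_el σ τ).symm

theorem coeff_el (σ τ : S n) : coeff σ (el τ) = if τ = σ then 1 else 0 :=
  Finsupp.single_apply

theorem pairing₁_apply (x y : A n) : pairing₁ n x y = ∑ σ, coeff σ x * coeff σ y := rfl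

theorem pairing₁_sum_sum (a b : S n → ℂ) :
    pairing₁ n (∑ σ, a σ • el σ) (∑ σ, b σ • el σ) = ∑ σ, a σ * b σ := by
  rw [pairing₁_apply]
  simp [coeff_el]

theorem pairing₁_comm (x y : A n) : pairing₁ n x y = pairing₁ n y x := by
  simp only [pairing₁_apply, mul_comm]

theorem pairing₂_tmul (a b c d : A n) :
    pairing₂ n (a ⊗ₜ b) (c ⊗ₜ d) = pairing₁ n a c * pairing₁ n b d := by
  rw [pairing₂, mul_comm]; simp

theorem pairing₃_tmul (a b c d e f : A n) : pairing₃ n (a ⊗ₜ b ⊗ₜ c) (d ⊗ₜ e ⊗ₜ f) =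
    pairing₁ n a d * pairing₁ n b e * pairing₁ n c f := by
  rw [← pairing₂_tmul, pairing₃, mul_comm]; simp

theorem span_el : Submodule.span ℂ (Set.range (el : S n → A n)) = ⊤ := by
  rw [eq_top_iff]
  rintro x -
  have h : ∀ x : MonoidAlgebra ℂ (S n), (x : A n) ∈ Submodule.span ℂ (Set.range (el : S n → A n)) := by
    intro x
    induction x using MonoidAlgebra.induction_on with
    | of g => exact Submodule.subset_span ⟨g, rfl⟩
    | add x y hx hy => exact Submodule.add_mem _ hx hy
    | smul c x hx => exact Submodule.smul_mem _ c hx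
  exact h x

/-- The matrix units of `ℂ(S_n)`. -/
noncomputable def unit (B : OrthogonalBases n) (R : n.Partition) (i j : Fin (dim R)) : A n :=
  B.matUnit (elHom n) R i j

variable (B : OrthogonalBases n)

theorem unit_eq (R : n.Partition) (i j : Fin (dim R)) :
    unit B R i j = ((dim R : ℂ) / n.factorial) • ∑ σ, (B.D R σ i j : ℂ) • el σ := by
  rw [unit, OrthogonalBases.matUnit, ← Complex.coe_smul]
  push_cast
  congr 1

theorem factorial_ne_zero_complex (n : ℕ) : (n.factorial : ℂ) ≠ 0 :=
  Nat.cast_ne_zero.2 n.factorial_ne_zero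

theorem dim_ne_zero_complex (R : n.Partition) : (dim R : ℂ) ≠ 0 :=
  Nat.cast_ne_zero.2 (dim_pos R).ne'

theorem z_eq (R : n.Partition) :
    z R = ((n.factorial : ℂ) / dim R) • ∑ i, unit B R i i := by
  have h1 := B.sum_matUnit_self (elHom n) R
  rw [← Complex.coe_smul] at h1
  change ∑ i, unit B R i i = _ at h1
  rw [h1, smul_smul]
  have : (n.factorial : ℂ) / dim R * (((dim R : ℝ) / n.factorial : ℝ) : ℂ) = 1 := by
    have := dim_ne_zero_complex R
    have := factorial_ne_zero_complex n
    push_cast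
    field_simp
  rw [this, one_smul]
  rfl

theorem sum_D_mul_chi (R R' : n.Partition) (i j : Fin (dim R)) (σ : S n) :
    ∑ τ, B.D R τ i j * chi R' (τ * σ⁻¹) =
      if R = R' then (n.factorial : ℝ) / dim R * B.D R σ i j else 0 := by
  simp only [B.chi_eq_sum, B.D_mul, Matrix.mul_apply, Finset.mul_sum, B.D_inv_apply]
  rw [Finset.sum_comm, Finset.sum_congr rfl fun i _ => Finset.sum_comm]
  simp only [← mul_assoc, ← Finset.sum_mul]
  split_ifs with h
  · subst h
    simp only [B.sum_D_mul_D]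
    rw [Finset.sum_eq_single i, Finset.sum_eq_single j]
    · simp
    · intro k _ hk
      simp [hk.symm]
    · simp
    · intro k _ hk
      simp [hk.symm]
    · simp
  · simp [B.sum_D_mul_D_of_ne h]

theorem z_mul_el (R : n.Partition) (σ : S n) :
    z R * el σ = ∑ τ, (chi R (τ * σ⁻¹) : ℂ) • el τ := by
  rw [z, Finset.sum_mul]
  refine Fintype.sum_equiv (Equiv.mulRight σ) _ _ fun τ => ?_
  simp [el_mul_el]

/-- The basic evaluation behind both duality formulas: pairing a matrix unit with z_{R'} σ selects
R' = R and reads off a matrix entry of σ, with all normalizing constants cancelling. -/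
theorem pairing₁_unit_z_mul_el (R R' : n.Partition) (i j : Fin (dim R)) (σ : S n) :
    pairing₁ n (unit B R i j) (z R' * el σ) =
      if R = R' then (B.D R σ i j : ℂ) else 0 := by
  rw [unit_eq, z_mul_el, map_smul, LinearMap.smul_apply, pairing₁_sum_sum]
  simp only [← Complex.ofReal_mul]
  rw [← Complex.ofReal_sum, sum_D_mul_chi]
  split_ifs
  · have := dim_ne_zero_complex R
    have := factorial_ne_zero_complex n
    push_cast
    rw [smul_eq_mul]
    field_simp
  · simp

theorem pairing₂_unit_zTriple (R₁ R₂ R₁' R₂' R₃' : n.Partition) (x y : Fin (dim R₁) × Fin (dim R₂)) :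
    pairing₂ n (unit B R₁ x.1 y.1 ⊗ₜ unit B R₂ x.2 y.2) (zTriple R₁' R₂' R₃') =
      if R₁ = R₁' ∧ R₂ = R₂' then
        ((∑ σ, tensorRep B R₁ R₂ σ x y * chi R₃' σ : ℝ) : ℂ) else 0 := by
  rw [zTriple, Finset.mul_sum, map_sum]
  simp only [mul_smul_comm, Algebra.TensorProduct.tmul_mul_tmul, map_smul, pairing₂_tmul,
    pairing₁_unit_z_mul_el, tensorRep_apply, smul_eq_mul]
  by_cases h1 : R₁ = R₁' <;> by_cases h2 : R₂ = R₂' <;> simp [h1, h2, mul_comm]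

end GroupAlgebra

/-! ### Duality of the Fourier elements with the central families -/

section FourierElements

variable {n : ℕ} {B : OrthogonalBases n} (cg : ClebschGordan B)

theorem sum_smul_tmul {ι α M N : Type*} [Fintype ι] [Fintype α] [AddCommGroup M] [Module ℂ M]
    [AddCommGroup N] [Module ℂ N] (c : ι → ℂ) (f g : ι → α → ℂ) (u : α → M) (v : α → N) :
    ∑ σ, ∑ τ, (∑ x, c x * f x σ * g x τ) • (u σ ⊗ₜ[ℂ] v τ) =
      ∑ x, c x • ((∑ σ, f x σ • u σ) ⊗ₜ[ℂ] (∑ τ, g x τ • v τ)) := by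
  have h : ∀ x, c x • ((∑ σ, f x σ • u σ) ⊗ₜ[ℂ] (∑ τ, g x τ • v τ)) =
      ∑ σ, ∑ τ, (c x * f x σ * g x τ) • (u σ ⊗ₜ[ℂ] v τ) := fun x => by
    rw [TensorProduct.sum_tmul, Finset.smul_sum]
    refine Finset.sum_congr rfl fun σ _ => ?_
    rw [TensorProduct.tmul_sum, Finset.smul_sum]
    refine Finset.sum_congr rfl fun τ _ => ?_
    rw [TensorProduct.smul_tmul_smul, smul_smul, mul_assoc]
  simp only [h, Finset.sum_smul]
  symm
  rw [Finset.sum_comm]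
  refine Finset.sum_congr rfl fun σ _ => ?_
  rw [Finset.sum_comm]

theorem Q_eq (R₁ R₂ R₃ : n.Partition) (τ₁ τ₂ : Fin (cg.mult R₁ R₂ R₃)) :
    Q cg R₁ R₂ R₃ τ₁ τ₂ = ∑ p : (Fin (dim R₁) × Fin (dim R₂)) × (Fin (dim R₁) × Fin (dim R₂)),
      ((∑ i, cg.mat R₁ R₂ R₃ τ₁ p.1 i * cg.mat R₁ R₂ R₃ τ₂ p.2 i : ℝ) : ℂ) •
        (unit B R₁ p.1.1 p.2.1 ⊗ₜ[ℂ] unit B R₂ p.1.2 p.2.2) := by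
  have h1 : ∀ σ₁ σ₂ : S n, ((∑ i₁, ∑ i₂, ∑ i₃, ∑ j₁, ∑ j₂,
        cg.coeff R₁ R₂ R₃ τ₁ i₁ i₂ i₃ * cg.coeff R₁ R₂ R₃ τ₂ j₁ j₂ i₃ *
          B.D R₁ σ₁ i₁ j₁ * B.D R₂ σ₂ i₂ j₂ : ℝ) : ℂ) =
      ∑ p : (Fin (dim R₁) × Fin (dim R₂)) × (Fin (dim R₁) × Fin (dim R₂)),
        ((∑ i, cg.mat R₁ R₂ R₃ τ₁ p.1 i * cg.mat R₁ R₂ R₃ τ₂ p.2 i : ℝ) : ℂ) *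
          (B.D R₁ σ₁ p.1.1 p.2.1 : ℂ) * (B.D R₂ σ₂ p.1.2 p.2.2 : ℂ) := by
    intro σ₁ σ₂
    simp only [Fintype.sum_prod_type, ClebschGordan.mat_apply]
    push_cast
    refine Finset.sum_congr rfl fun i₁ _ => Finset.sum_congr rfl fun i₂ _ => ?_
    rw [Finset.sum_comm]
    refine Finset.sum_congr rfl fun j₁ _ => ?_
    rw [Finset.sum_comm]
    simp only [Finset.sum_mul]
  simp only [Q, h1, sum_smul_tmul, Finset.smul_sum]
  refine Finset.sum_congr rfl fun p _ => ?_
  rw [unit_eq, unit_eq, TensorProduct.smul_tmul_smul, smul_comm]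
  congr 2
  rw [div_mul_div_comm, pow_two]

/-- Contracting D^{R₁} ⊗ D^{R₂} with the coefficients of one copy τ and summing over i₃ gives the
trace χ^{R₃}; orthogonality against χ^{R₃'} gives n!. Each copy contributes equally, whence the
Kronecker coefficient in the pairing with P. -/
theorem pairing₂_Q_zTriple (R₁ R₂ R₃ R₁' R₂' R₃' : n.Partition)
    (τ : Fin (cg.mult R₁ R₂ R₃)) :
    pairing₂ n (Q cg R₁ R₂ R₃ τ τ) (zTriple R₁' R₂' R₃') =
      if R₁ = R₁' ∧ R₂ = R₂' ∧ R₃ = R₃' then (n.factorial : ℂ) else 0 := by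
  rw [Q_eq, map_sum, LinearMap.sum_apply]
  simp only [map_smul, LinearMap.smul_apply, pairing₂_unit_zTriple]
  by_cases h : R₁ = R₁' ∧ R₂ = R₂'
  · simp only [if_pos h, smul_eq_mul, ← Complex.ofReal_mul, ← Complex.ofReal_sum]
    have h1 : ∑ p : (Fin (dim R₁) × Fin (dim R₂)) × (Fin (dim R₁) × Fin (dim R₂)),
        (∑ i, cg.mat R₁ R₂ R₃ τ p.1 i * cg.mat R₁ R₂ R₃ τ p.2 i) *
          ∑ σ, tensorRep B R₁ R₂ σ p.1 p.2 * chi R₃' σ =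
        ∑ σ, chi R₃ σ * chi R₃' σ := by
      simp only [Finset.mul_sum]
      rw [Finset.sum_comm]
      refine Finset.sum_congr rfl fun σ _ => ?_
      simp only [← mul_assoc, ← Finset.sum_mul]
      congr 1
      rw [B.chi_eq_sum]
      simp only [← cg.sum_mat_mul_tensorRep R₁ R₂ R₃ τ σ, Finset.sum_mul]
      rw [Finset.sum_comm, Finset.sum_congr rfl fun i _ => Fintype.sum_prod_type _]
    rw [h1, OrthogonalBases.sum_chi_mul_chi]
    by_cases h3 : R₃ = R₃' <;> simp [h, h3]
  · have h' : ¬ (R₁ = R₁' ∧ R₂ = R₂' ∧ R₃ = R₃') := fun h' => h ⟨h'.1, h'.2.1⟩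
    simp only [if_neg h, if_neg h', smul_zero, Finset.sum_const_zero]

theorem pairing₂_P_zTriple (R₁ R₂ R₃ R₁' R₂' R₃' : n.Partition) :
    pairing₂ n (P cg R₁ R₂ R₃) (zTriple R₁' R₂' R₃') =
      if R₁ = R₁' ∧ R₂ = R₂' ∧ R₃ = R₃' then
        (n.factorial : ℂ) * (kronecker R₁ R₂ R₃ : ℂ) else 0 := by
  rw [P, map_sum, LinearMap.sum_apply]
  simp only [pairing₂_Q_zTriple, Finset.sum_const, Finset.card_univ, Fintype.card_fin,
    cg.kronecker_eq_mult]
  split_ifs <;> simp [mul_comm]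

theorem sum_smul_tmul_tmul {ι α M : Type*} [Fintype ι] [Fintype α] [AddCommGroup M]
    [Module ℂ M] (c : ι → ℂ) (f g h : ι → α → ℂ) (u : α → M) :
    ∑ σ, ∑ τ, ∑ ρ, (∑ x, c x * f x σ * g x τ * h x ρ) • (u σ ⊗ₜ[ℂ] u τ ⊗ₜ[ℂ] u ρ) =
      ∑ x, c x • ((∑ σ, f x σ • u σ) ⊗ₜ[ℂ] (∑ τ, g x τ • u τ) ⊗ₜ[ℂ] (∑ ρ, h x ρ • u ρ)) := by
  have h0 : ∀ x, c x • ((∑ σ, f x σ • u σ) ⊗ₜ[ℂ] (∑ τ, g x τ • u τ) ⊗ₜ[ℂ] (∑ ρ, h x ρ • u ρ)) =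
      ∑ σ, ∑ τ, ∑ ρ, (c x * f x σ * g x τ * h x ρ) • (u σ ⊗ₜ[ℂ] u τ ⊗ₜ[ℂ] u ρ) := fun x => by
    rw [TensorProduct.sum_tmul, TensorProduct.sum_tmul, Finset.smul_sum]
    refine Finset.sum_congr rfl fun σ _ => ?_
    rw [TensorProduct.tmul_sum (f x σ • u σ), TensorProduct.sum_tmul, Finset.smul_sum]
    refine Finset.sum_congr rfl fun τ _ => ?_
    rw [TensorProduct.tmul_sum, Finset.smul_sum]
    refine Finset.sum_congr rfl fun ρ _ => ?_
    rw [TensorProduct.smul_tmul_smul, TensorProduct.smul_tmul_smul, smul_smul, mul_assoc, mul_assoc,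
      mul_assoc]
  simp only [h0, Finset.sum_smul]
  symm
  rw [Finset.sum_comm]
  refine Finset.sum_congr rfl fun σ _ => ?_
  rw [Finset.sum_comm]
  refine Finset.sum_congr rfl fun τ _ => ?_
  rw [Finset.sum_comm]

theorem Qun_eq (R₁ R₂ R₃ : n.Partition) (τ₁ τ₂ : Fin (cg.mult R₁ R₂ R₃)) :
    Qun cg R₁ R₂ R₃ τ₁ τ₂ = ∑ p : Fin (dim R₁) × Fin (dim R₂) × Fin (dim R₃) ×
        Fin (dim R₁) × Fin (dim R₂) × Fin (dim R₃),
      ((cg.coeff R₁ R₂ R₃ τ₁ p.1 p.2.1 p.2.2.1 *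
        cg.coeff R₁ R₂ R₃ τ₂ p.2.2.2.1 p.2.2.2.2.1 p.2.2.2.2.2 : ℝ) : ℂ) •
        (unit B R₁ p.1 p.2.2.2.1 ⊗ₜ[ℂ] unit B R₂ p.2.1 p.2.2.2.2.1 ⊗ₜ[ℂ]
          unit B R₃ p.2.2.1 p.2.2.2.2.2) := by
  have h1 : ∀ σ₁ σ₂ σ₃ : S n, ((∑ i₁, ∑ i₂, ∑ i₃, ∑ j₁, ∑ j₂, ∑ j₃,
        cg.coeff R₁ R₂ R₃ τ₁ i₁ i₂ i₃ * cg.coeff R₁ R₂ R₃ τ₂ j₁ j₂ j₃ *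
          B.D R₁ σ₁ i₁ j₁ * B.D R₂ σ₂ i₂ j₂ * B.D R₃ σ₃ i₃ j₃ : ℝ) : ℂ) =
      ∑ p : Fin (dim R₁) × Fin (dim R₂) × Fin (dim R₃) ×
        Fin (dim R₁) × Fin (dim R₂) × Fin (dim R₃),
        ((cg.coeff R₁ R₂ R₃ τ₁ p.1 p.2.1 p.2.2.1 *
          cg.coeff R₁ R₂ R₃ τ₂ p.2.2.2.1 p.2.2.2.2.1 p.2.2.2.2.2 : ℝ) : ℂ) *
          (B.D R₁ σ₁ p.1 p.2.2.2.1 : ℂ) * (B.D R₂ σ₂ p.2.1 p.2.2.2.2.1 : ℂ) *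
          (B.D R₃ σ₃ p.2.2.1 p.2.2.2.2.2 : ℂ) := by
    intro σ₁ σ₂ σ₃
    simp only [Fintype.sum_prod_type]
    push_cast
    rfl
  simp only [Qun, h1, sum_smul_tmul_tmul, Finset.smul_sum]
  refine Finset.sum_congr rfl fun p _ => ?_
  rw [unit_eq, unit_eq, unit_eq, TensorProduct.smul_tmul_smul, TensorProduct.smul_tmul_smul,
    smul_comm]
  congr 2
  rw [div_mul_div_comm, div_mul_div_comm, pow_three, mul_assoc (n.factorial : ℂ)]

theorem sum_D_mul_self (R : n.Partition) (γ : S n) (B : OrthogonalBases n) :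
    ∑ i, ∑ j, B.D R γ i j * B.D R γ i j = dim R := by
  have h1 : (B.D R γ * B.D R γ⁻¹).trace = dim R := by
    rw [← B.D_mul, mul_inv_cancel, B.D_one, Matrix.trace_one, Fintype.card_fin]
  rw [← h1, Matrix.trace]
  refine Finset.sum_congr rfl fun i _ => ?_
  rw [Matrix.diag_apply, Matrix.mul_apply]
  exact Finset.sum_congr rfl fun j _ => by rw [B.D_inv_apply]

/-- Contraction over the first two factors leaves D^{R₃}_{ij}(γ), so the whole sum is the trace of D
Dᵀ = 1. In particular it does not depend on γ. -/
theorem ClebschGordan.sum_coeff_mul_D (R₁ R₂ R₃ : n.Partition) (τ : Fin (cg.mult R₁ R₂ R₃))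
    (γ : S n) : ∑ p : Fin (dim R₁) × Fin (dim R₂) × Fin (dim R₃) ×
        Fin (dim R₁) × Fin (dim R₂) × Fin (dim R₃),
      cg.coeff R₁ R₂ R₃ τ p.1 p.2.1 p.2.2.1 *
        cg.coeff R₁ R₂ R₃ τ p.2.2.2.1 p.2.2.2.2.1 p.2.2.2.2.2 *
        (B.D R₁ γ p.1 p.2.2.2.1 * B.D R₂ γ p.2.1 p.2.2.2.2.1 *
          B.D R₃ γ p.2.2.1 p.2.2.2.2.2) = dim R₃ := by
  have h1 : ∑ x, ∑ i, ∑ y, ∑ j, cg.mat R₁ R₂ R₃ τ x i * cg.mat R₁ R₂ R₃ τ y j *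
      (tensorRep B R₁ R₂ γ x y * B.D R₃ γ i j) = dim R₃ := by
    rw [← sum_D_mul_self R₃ γ B, Finset.sum_comm]
    refine Finset.sum_congr rfl fun i _ => ?_
    rw [Finset.sum_congr rfl fun x _ => Finset.sum_comm, Finset.sum_comm]
    refine Finset.sum_congr rfl fun j _ => ?_
    simp only [← mul_assoc, ← Finset.sum_mul, cg.sum_mat_mul_tensorRep]
  rw [← h1]
  simp only [Fintype.sum_prod_type, ClebschGordan.mat_apply, tensorRep_apply]

theorem zUn_mul_diag₃ (R₁ R₂ R₃ : n.Partition) (γ : S n) :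
    zUn R₁ R₂ R₃ * diag₃ γ = (z R₁ * el γ) ⊗ₜ[ℂ] (z R₂ * el γ) ⊗ₜ[ℂ] (z R₃ * el γ) := by
  rw [zUn, diag₃, Algebra.TensorProduct.tmul_mul_tmul, Algebra.TensorProduct.tmul_mul_tmul]

theorem pairing₃_zUn_mul_diag₃_Qun (R₁ R₂ R₃ R₁' R₂' R₃' : n.Partition)
    (τ : Fin (cg.mult R₁ R₂ R₃)) (γ : S n) :
    pairing₃ n (zUn R₁' R₂' R₃' * diag₃ γ) (Qun cg R₁ R₂ R₃ τ τ) =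
      if R₁ = R₁' ∧ R₂ = R₂' ∧ R₃ = R₃' then (dim R₃ : ℂ) else 0 := by
  rw [Qun_eq, map_sum, zUn_mul_diag₃]
  simp only [map_smul, pairing₃_tmul, pairing₁_comm (z _ * el _), pairing₁_unit_z_mul_el]
  by_cases h : R₁ = R₁' ∧ R₂ = R₂' ∧ R₃ = R₃'
  · simp only [if_pos h.1, if_pos h.2.1, if_pos h.2.2, if_pos h, smul_eq_mul,
      ← Complex.ofReal_mul, ← Complex.ofReal_sum, cg.sum_coeff_mul_D, Complex.ofReal_natCast]
  · rw [if_neg h]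
    refine Finset.sum_eq_zero fun p _ => ?_
    by_cases h1 : R₁ = R₁'
    · by_cases h2 : R₂ = R₂'
      · rw [if_neg fun h3 => h ⟨h1, h2, h3⟩, mul_zero, smul_zero]
      · rw [if_neg h2, mul_zero, zero_mul, smul_zero]
    · rw [if_neg h1, zero_mul, zero_mul, smul_zero]

/-- The factor γ is kept because the value is independent of it: γ = 1 gives the pairing with z_un,
and averaging over γ gives the pairing with its double coset class. -/
theorem pairing₃_zUn_mul_diag₃_Pun (R₁ R₂ R₃ R₁' R₂' R₃' : n.Partition) (γ : S n) :
    pairing₃ n (zUn R₁' R₂' R₃' * diag₃ γ) (Pun cg R₁ R₂ R₃) =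
      if R₁ = R₁' ∧ R₂ = R₂' ∧ R₃ = R₃' then
        (dim R₃ : ℂ) * (kronecker R₁ R₂ R₃ : ℂ) else 0 := by
  rw [Pun, map_sum]
  simp only [pairing₃_zUn_mul_diag₃_Qun, Finset.sum_const, Finset.card_univ, Fintype.card_fin,
    cg.kronecker_eq_mult]
  split_ifs <;> simp [mul_comm]

end FourierElements

/-! ### Centres of corners of matrix algebras -/

section Corner

/-- A central element `x` of a corner `e𝒜e` is a multiple of `e` on each matrix block. -/
theorem exists_mul_eq_smul_of_corner {𝒜 κ : Type*} [Ring 𝒜] [Algebra ℂ 𝒜] [Fintype κ]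
    (E : κ → κ → 𝒜) (hne : ∀ i, E i i ≠ 0)
    (hc : ∀ u : 𝒜, ∃ c : κ → κ → ℂ, ∀ i j k l, E i j * u * E k l = c j k • E i l)
    {p : 𝒜} (hp : p = ∑ i, E i i) (hpp : p * p = p) (hcentral : ∀ u, u * p = p * u) {e x : 𝒜}
    (hxe : x * e = x) (hcomm : ∀ y, x * y * e = e * y * x) : ∃ μ : ℂ, x * p = μ • (e * p) := by
  have hexp : ∀ (u : 𝒜) (c : κ → κ → ℂ), (∀ i j k l, E i j * u * E k l = c j k • E i l) →
      u * p = ∑ i, ∑ j, c i j • E i j := by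
    intro u c h
    rw [← hpp, ← mul_assoc, hcentral u, hp, Finset.sum_mul, Finset.sum_mul]
    refine Finset.sum_congr rfl fun i _ => ?_
    rw [Finset.mul_sum]
    exact Finset.sum_congr rfl fun j _ => h _ _ _ _
  obtain ⟨ce, hce⟩ := hc e
  obtain ⟨cx, hcx⟩ := hc x
  by_cases h0 : ∃ j l, ce j l ≠ 0
  · obtain ⟨j, l, hjl⟩ := h0
    -- With cx and ce the matrices of x and e in the block, `hcomm` for y = E i j, compressed
    -- between E j k and E l j, says that the two matrices are proportional.
    have key : ∀ k i, cx k i * ce j l = ce k i * cx j l := by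
      intro k i
      have h1 : E j k * x * E i j * e * E l j = E j k * e * E i j * x * E l j := by
        have := congrArg (fun u => E j k * u * E l j) (hcomm (E i j))
        simpa only [mul_assoc] using this
      rw [hcx, hce, smul_mul_assoc, smul_mul_assoc, smul_mul_assoc, smul_mul_assoc, hce, hcx,
        smul_smul, smul_smul] at h1
      exact smul_left_injective ℂ (hne j) h1
    refine ⟨cx j l / ce j l, ?_⟩
    rw [hexp x cx hcx, hexp e ce hce, Finset.smul_sum]
    refine Finset.sum_congr rfl fun k _ => ?_
    rw [Finset.smul_sum]
    refine Finset.sum_congr rfl fun i _ => ?_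
    rw [smul_smul]
    congr 1
    rw [div_mul_eq_mul_div, eq_div_iff hjl, key, mul_comm]
  -- If e vanishes on the block, so does x = x e.
  · push Not at h0
    have h1 : e * p = 0 := by
      rw [hexp e ce hce]
      simp [h0]
    exact ⟨0, by rw [← hxe, mul_assoc, h1, mul_zero, zero_smul]⟩

end Corner

/-! ### The double coset algebra and its centre -/

section DoubleCoset

variable {n : ℕ}

theorem diag₃_mul_diag₃ (σ τ : S n) : diag₃ σ * diag₃ τ = diag₃ (σ * τ) := by
  simp only [diag₃, Algebra.TensorProduct.tmul_mul_tmul, el_mul_el]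

/-- The average of the diagonal permutations. -/
noncomputable def diagAverage (n : ℕ) : A₃ n := (n.factorial : ℂ)⁻¹ • ∑ γ : S n, diag₃ γ

theorem diag₃_mul_diagAverage (γ : S n) : diag₃ γ * diagAverage n = diagAverage n := by
  rw [diagAverage, mul_smul_comm, Finset.mul_sum]
  congr 1
  exact Fintype.sum_equiv (Equiv.mulLeft γ) _ _ fun σ => diag₃_mul_diag₃ γ σ

theorem diagAverage_mul_diag₃ (γ : S n) : diagAverage n * diag₃ γ = diagAverage n := by
  rw [diagAverage, smul_mul_assoc, Finset.sum_mul]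
  congr 1
  exact Fintype.sum_equiv (Equiv.mulRight γ) _ _ fun σ => diag₃_mul_diag₃ σ γ

theorem average_eq {M : Type*} [AddCommGroup M] [Module ℂ M] {f : S n → M} {x : M}
    (h : ∀ γ, f γ = x) : (n.factorial : ℂ)⁻¹ • ∑ γ, f γ = x := by
  simp only [h, Finset.sum_const, Finset.card_univ, Fintype.card_perm, Fintype.card_fin]
  rw [← Nat.cast_smul_eq_nsmul ℂ, smul_smul, inv_mul_cancel₀ (factorial_ne_zero_complex n),
    one_smul]

theorem diagAverage_mul_self : diagAverage n * diagAverage n = diagAverage n := by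
  conv_lhs => rw [diagAverage, smul_mul_assoc, Finset.sum_mul]
  exact average_eq fun γ => diag₃_mul_diagAverage γ

theorem mem_Kun {x : A₃ n} : x ∈ Kun n ↔ diagAverage n * x = x ∧ x * diagAverage n = x := by
  constructor
  · intro h
    constructor
    · rw [diagAverage, smul_mul_assoc, Finset.sum_mul]
      exact average_eq fun γ => (h γ).1
    · rw [diagAverage, mul_smul_comm, Finset.mul_sum]
      exact average_eq fun γ => (h γ).2
  · rintro ⟨h1, h2⟩ γ
    constructor
    · rw [← h1, ← mul_assoc, diag₃_mul_diagAverage]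
    · rw [← h2, mul_assoc, diagAverage_mul_diag₃]

theorem cosetMap_apply (x : A₃ n) : cosetMap n x = diagAverage n * x * diagAverage n := by
  simp only [cosetMap, LinearMap.smul_apply, LinearMap.sum_apply, LinearMap.comp_apply,
    LinearMap.mulLeft_apply, LinearMap.mulRight_apply]
  rw [diagAverage, smul_mul_assoc, smul_mul_assoc, mul_smul_comm, smul_smul, pow_two, mul_inv,
    Finset.sum_mul, Finset.sum_mul_sum]
  simp only [mul_assoc]

theorem mem_centreKun {x : A₃ n} :
    x ∈ centreKun n ↔ x ∈ Kun n ∧ ∀ y ∈ Kun n, x * y = y * x := by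
  constructor
  · rintro ⟨⟨x, hx⟩, h, rfl⟩
    refine ⟨hx, fun y hy => ?_⟩
    have := (NonUnitalSubalgebra.mem_center_iff (R := ℂ)).1 h ⟨y, hy⟩
    exact (congrArg Subtype.val this).symm
  · rintro ⟨hx, h⟩
    refine ⟨⟨x, hx⟩, ?_, rfl⟩
    exact (NonUnitalSubalgebra.mem_center_iff (R := ℂ)).2
      fun y => Subtype.ext (h y y.2).symm

theorem z_mul_comm (R : n.Partition) (x : A n) : z R * x = x * z R := by
  have h : x ∈ Submodule.span ℂ (Set.range (el : S n → A n)) := span_el ▸ Submodule.mem_top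
  induction h using Submodule.span_induction with
  | mem x hx =>
    obtain ⟨σ, rfl⟩ := hx
    rw [z, Finset.sum_mul, Finset.mul_sum]
    refine Fintype.sum_equiv (MulAut.conj σ⁻¹).toEquiv _ _ fun τ => ?_
    have h1 : (MulAut.conj σ⁻¹).toEquiv τ = σ⁻¹ * τ * σ := by simp
    have h2 := chi_conj R τ σ⁻¹
    rw [inv_inv] at h2
    rw [h1, h2, smul_mul_assoc, mul_smul_comm, el_mul_el, el_mul_el]
    congr 2
    group
  | zero => simp
  | add x y _ _ hx hy => rw [mul_add, add_mul, hx, hy]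
  | smul c x _ hx => rw [mul_smul_comm, smul_mul_assoc, hx]

theorem zUn_mul_comm (R₁ R₂ R₃ : n.Partition) (x : A₃ n) :
    zUn R₁ R₂ R₃ * x = x * zUn R₁ R₂ R₃ := by
  induction x using TensorProduct.induction_on with
  | zero => simp
  | add x y hx hy => rw [mul_add, add_mul, hx, hy]
  | tmul x c =>
    induction x using TensorProduct.induction_on with
    | zero => simp
    | add x y hx hy => rw [TensorProduct.add_tmul, mul_add, add_mul, hx, hy]
    | tmul a b =>
      simp only [zUn, Algebra.TensorProduct.tmul_mul_tmul, z_mul_comm]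

/-- Since z_un is central and e is idempotent, e z e collapses to z e. -/
theorem cosetMap_zUn (R₁ R₂ R₃ : n.Partition) :
    cosetMap n (zUn R₁ R₂ R₃) = zUn R₁ R₂ R₃ * diagAverage n := by
  rw [cosetMap_apply, ← zUn_mul_comm, mul_assoc, diagAverage_mul_self]

theorem cosetMap_zUn_mem_centreKun (R₁ R₂ R₃ : n.Partition) :
    cosetMap n (zUn R₁ R₂ R₃) ∈ centreKun n := by
  rw [mem_centreKun, cosetMap_zUn]
  refine ⟨mem_Kun.2 ⟨?_, ?_⟩, fun y hy => ?_⟩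
  · rw [zUn_mul_comm, ← mul_assoc, diagAverage_mul_self]
  · rw [mul_assoc, diagAverage_mul_self]
  · rw [mem_Kun] at hy
    rw [mul_assoc, hy.1, zUn_mul_comm R₁ R₂ R₃ (diagAverage n), ← mul_assoc, hy.2, zUn_mul_comm]

theorem pairing₃_cosetMap_zUn_Pun {B : OrthogonalBases n} (cg : ClebschGordan B)
    (R₁ R₂ R₃ R₁' R₂' R₃' : n.Partition) :
    pairing₃ n (cosetMap n (zUn R₁' R₂' R₃')) (Pun cg R₁ R₂ R₃) =
      if R₁ = R₁' ∧ R₂ = R₂' ∧ R₃ = R₃' then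
        (dim R₃ : ℂ) * (kronecker R₁ R₂ R₃ : ℂ) else 0 := by
  rw [cosetMap_zUn, diagAverage, mul_smul_comm, Finset.mul_sum, map_smul, map_sum,
    LinearMap.smul_apply, LinearMap.sum_apply]
  exact average_eq fun γ => pairing₃_zUn_mul_diag₃_Pun cg _ _ _ _ _ _ γ

variable (B : OrthogonalBases n)

/-- Indices of the matrix units in a block of `ℂ(S_n)^{⊗3}`. -/
abbrev BlockIndex (t : n.Partition × n.Partition × n.Partition) : Type :=
  Fin (dim t.1) × Fin (dim t.2.1) × Fin (dim t.2.2)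

/-- The matrix units of `ℂ(S_n)^{⊗3}`. -/
noncomputable def unit₃ (t : n.Partition × n.Partition × n.Partition) (x y : BlockIndex t) : A₃ n :=
  unit B t.1 x.1 y.1 ⊗ₜ[ℂ] unit B t.2.1 x.2.1 y.2.1 ⊗ₜ[ℂ] unit B t.2.2 x.2.2 y.2.2

theorem unit_mul_unit (R : n.Partition) (i j k l : Fin (dim R)) :
    unit B R i j * unit B R k l = if j = k then unit B R i l else 0 :=
  B.matUnit_mul_matUnit _ R i j k l

theorem unit_mul_el_mul_unit (R : n.Partition) (i j k l : Fin (dim R)) (σ : S n) :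
    unit B R i j * el σ * unit B R k l = (B.D R σ j k : ℂ) • unit B R i l := by
  have h1 : unit B R i j * el σ = ∑ k, (B.D R σ j k : ℂ) • unit B R i k := by
    simp only [Complex.coe_smul]
    exact B.matUnit_mul (elHom n) R i j σ
  rw [h1, Finset.sum_mul]
  simp [unit_mul_unit]

theorem exists_unit_mul_mul_unit (R : n.Partition) (u : A n) :
    ∃ c : Fin (dim R) → Fin (dim R) → ℂ, ∀ i j k l,
      unit B R i j * u * unit B R k l = c j k • unit B R i l := by
  have h : u ∈ Submodule.span ℂ (Set.range (el : S n → A n)) := span_el ▸ Submodule.mem_top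
  induction h using Submodule.span_induction with
  | mem x hx =>
    obtain ⟨σ, rfl⟩ := hx
    exact ⟨fun j k => B.D R σ j k, fun i j k l => unit_mul_el_mul_unit B R i j k l σ⟩
  | zero => exact ⟨0, by simp⟩
  | add x y _ _ hx hy =>
    obtain ⟨c, hc⟩ := hx
    obtain ⟨d, hd⟩ := hy
    exact ⟨c + d, fun i j k l => by
      rw [mul_add, add_mul, hc, hd, Pi.add_apply, Pi.add_apply, add_smul]⟩
  | smul a x _ hx =>
    obtain ⟨c, hc⟩ := hx
    exact ⟨a • c, fun i j k l => by
      rw [mul_smul_comm, smul_mul_assoc, hc, Pi.smul_apply, Pi.smul_apply, smul_assoc]⟩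

/-- Supplies the block hypothesis of `exists_mul_eq_smul_of_corner`: every element acts on a block
through a matrix of scalars. -/
theorem exists_unit₃_mul_mul_unit₃ (t : n.Partition × n.Partition × n.Partition) (u : A₃ n) :
    ∃ c : BlockIndex t → BlockIndex t → ℂ, ∀ i j k l,
      unit₃ B t i j * u * unit₃ B t k l = c j k • unit₃ B t i l := by
  have hadd : ∀ x y : A₃ n,
      (∃ c : BlockIndex t → BlockIndex t → ℂ, ∀ i j k l,
        unit₃ B t i j * x * unit₃ B t k l = c j k • unit₃ B t i l) →
      (∃ c : BlockIndex t → BlockIndex t → ℂ, ∀ i j k l,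
        unit₃ B t i j * y * unit₃ B t k l = c j k • unit₃ B t i l) →
      ∃ c : BlockIndex t → BlockIndex t → ℂ, ∀ i j k l,
        unit₃ B t i j * (x + y) * unit₃ B t k l = c j k • unit₃ B t i l := by
    rintro x y ⟨c, hc⟩ ⟨d, hd⟩
    exact ⟨c + d, fun i j k l => by
      rw [mul_add, add_mul, hc, hd, Pi.add_apply, Pi.add_apply, add_smul]⟩
  induction u using TensorProduct.induction_on with
  | zero => exact ⟨0, by simp⟩
  | add x y hx hy => exact hadd x y hx hy
  | tmul x w =>
    induction x using TensorProduct.induction_on with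
    | zero => exact ⟨0, by simp⟩
    | add x y hx hy => rw [TensorProduct.add_tmul]; exact hadd _ _ hx hy
    | tmul u v =>
      obtain ⟨a, ha⟩ := exists_unit_mul_mul_unit B t.1 u
      obtain ⟨b, hb⟩ := exists_unit_mul_mul_unit B t.2.1 v
      obtain ⟨c, hc⟩ := exists_unit_mul_mul_unit B t.2.2 w
      refine ⟨fun j k => a j.1 k.1 * b j.2.1 k.2.1 * c j.2.2 k.2.2, fun i j k l => ?_⟩
      simp only [unit₃, Algebra.TensorProduct.tmul_mul_tmul, ha, hb, hc,
        TensorProduct.smul_tmul_smul]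

theorem unit₃_self_ne_zero (t : n.Partition × n.Partition × n.Partition) (i : BlockIndex t) :
    unit₃ B t i i ≠ 0 := by
  intro h
  have h1 : pairing₃ n (unit₃ B t i i) (zUn t.1 t.2.1 t.2.2 * diag₃ 1) = 1 := by
    rw [zUn_mul_diag₃, unit₃, pairing₃_tmul, pairing₁_unit_z_mul_el, pairing₁_unit_z_mul_el,
      pairing₁_unit_z_mul_el, B.D_one, B.D_one, B.D_one]
    simp
  rw [h, map_zero, LinearMap.zero_apply] at h1
  exact zero_ne_one h1

/-- The central idempotents of `ℂ(S_n)`. -/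
noncomputable def idem (R : n.Partition) : A n := ∑ i, unit B R i i

/-- The central idempotents of `ℂ(S_n)^{⊗3}`. -/
noncomputable def idem₃ (t : n.Partition × n.Partition × n.Partition) : A₃ n :=
  idem B t.1 ⊗ₜ[ℂ] idem B t.2.1 ⊗ₜ[ℂ] idem B t.2.2

theorem idem₃_eq_sum (t : n.Partition × n.Partition × n.Partition) :
    idem₃ B t = ∑ i, unit₃ B t i i := by
  rw [idem₃, idem, TensorProduct.sum_tmul, TensorProduct.sum_tmul, Fintype.sum_prod_type]
  refine Finset.sum_congr rfl fun i _ => ?_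
  rw [idem, TensorProduct.tmul_sum, TensorProduct.sum_tmul, Fintype.sum_prod_type]
  refine Finset.sum_congr rfl fun j _ => ?_
  rw [idem, TensorProduct.tmul_sum]
  rfl

theorem idem_mul_self (R : n.Partition) : idem B R * idem B R = idem B R := by
  simp only [idem, Finset.sum_mul, Finset.mul_sum, unit_mul_unit]
  simp

theorem idem₃_mul_self (t : n.Partition × n.Partition × n.Partition) :
    idem₃ B t * idem₃ B t = idem₃ B t := by
  simp only [idem₃, Algebra.TensorProduct.tmul_mul_tmul, idem_mul_self]

theorem sum_idem : ∑ R, idem B R = 1 := B.sum_sum_matUnit_self (elHom n)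

theorem sum_idem₃ : ∑ t, idem₃ B t = 1 := by
  simp only [idem₃, Fintype.sum_prod_type, ← TensorProduct.tmul_sum, sum_idem,
    ← TensorProduct.sum_tmul]
  rfl

theorem exists_zUn_eq_smul (t : n.Partition × n.Partition × n.Partition) :
    ∃ c : ℂ, c ≠ 0 ∧ zUn t.1 t.2.1 t.2.2 = c • idem₃ B t := by
  refine ⟨(n.factorial : ℂ) / dim t.1 * ((n.factorial : ℂ) / dim t.2.1) *
    ((n.factorial : ℂ) / dim t.2.2), ?_, ?_⟩
  · have h := fun R : n.Partition =>
      div_ne_zero (factorial_ne_zero_complex n) (dim_ne_zero_complex R)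
    exact mul_ne_zero (mul_ne_zero (h _) (h _)) (h _)
  · simp only [zUn, z_eq B, TensorProduct.smul_tmul_smul, idem₃, idem]

theorem idem₃_mul_comm (t : n.Partition × n.Partition × n.Partition) (x : A₃ n) :
    x * idem₃ B t = idem₃ B t * x := by
  obtain ⟨c, hc, h⟩ := exists_zUn_eq_smul B t
  have h1 := zUn_mul_comm t.1 t.2.1 t.2.2 x
  rw [h, smul_mul_assoc, mul_smul_comm] at h1
  exact (smul_right_injective _ hc h1).symm

theorem exists_mul_idem₃ {x : A₃ n} (hx : x ∈ centreKun n)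
    (t : n.Partition × n.Partition × n.Partition) :
    ∃ μ : ℂ, x * idem₃ B t = μ • (diagAverage n * idem₃ B t) := by
  rw [mem_centreKun, mem_Kun] at hx
  refine exists_mul_eq_smul_of_corner (unit₃ B t) (unit₃_self_ne_zero B t)
    (exists_unit₃_mul_mul_unit₃ B t) (idem₃_eq_sum B t) (idem₃_mul_self B t) (idem₃_mul_comm B t)
    hx.1.2 fun y => ?_
  -- Commutation with the corner element e y e becomes x y e = e y x, for arbitrary y, because x = e
  -- x = x e.
  have h1 := hx.2 (diagAverage n * y * diagAverage n) (mem_Kun.2 ⟨by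
    rw [← mul_assoc, ← mul_assoc, diagAverage_mul_self], by
    rw [mul_assoc, diagAverage_mul_self]⟩)
  rw [mul_assoc (_ * y), hx.1.1, ← mul_assoc, ← mul_assoc, hx.1.2] at h1
  exact h1

theorem span_cosetMap_zUn :
    Submodule.span ℂ (Set.range fun t : n.Partition × n.Partition × n.Partition =>
      cosetMap n (zUn t.1 t.2.1 t.2.2)) = centreKun n := by
  obtain ⟨B⟩ := nonempty_orthogonalBases n
  refine le_antisymm (Submodule.span_le.2 ?_) fun x hx => ?_
  · rintro _ ⟨t, rfl⟩
    exact cosetMap_zUn_mem_centreKun _ _ _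
  · rw [← mul_one x, ← sum_idem₃ B, Finset.mul_sum]
    refine Submodule.sum_mem _ fun t _ => ?_
    obtain ⟨μ, hμ⟩ := exists_mul_idem₃ B hx t
    obtain ⟨c, hc, h⟩ := exists_zUn_eq_smul B t
    have h1 : diagAverage n * idem₃ B t = c⁻¹ • cosetMap n (zUn t.1 t.2.1 t.2.2) := by
      rw [cosetMap_zUn, zUn_mul_comm, h, mul_smul_comm, smul_smul, inv_mul_cancel₀ hc, one_smul]
    rw [hμ, h1]
    exact Submodule.smul_mem _ _ (Submodule.smul_mem _ _ (Submodule.subset_span ⟨t, rfl⟩))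

variable {B}

/-- The decomposition of V_{R₁} ⊗ V_{R₂} involves only R ≠ R₃, whose matrix entries are orthogonal
to those of R₃. -/
theorem sum_tensorRep_mul_D (cg : ClebschGordan B) {R₁ R₂ R₃ : n.Partition}
    (h : cg.mult R₁ R₂ R₃ = 0) (x y : Fin (dim R₁) × Fin (dim R₂)) (i j : Fin (dim R₃)) :
    ∑ γ, tensorRep B R₁ R₂ γ x y * B.D R₃ γ i j = 0 := by
  simp only [cg.tensorRep_eq, Matrix.sum_apply, Matrix.mul_apply, Finset.sum_mul]
  rw [Finset.sum_comm]
  refine Finset.sum_eq_zero fun R _ => ?_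
  rw [Finset.sum_comm]
  refine Finset.sum_eq_zero fun τ _ => ?_
  have hR : R ≠ R₃ := by
    rintro rfl
    exact (h ▸ τ).elim0
  rw [Finset.sum_comm]
  refine Finset.sum_eq_zero fun b _ => ?_
  rw [Finset.sum_comm]
  refine Finset.sum_eq_zero fun a _ => ?_
  have h1 : ∀ γ, cg.mat R₁ R₂ R τ x a * B.D R γ a b * (cg.mat R₁ R₂ R τ).transpose b y *
      B.D R₃ γ i j = cg.mat R₁ R₂ R τ x a * (cg.mat R₁ R₂ R τ).transpose b y *
        (B.D R γ a b * B.D R₃ γ i j) := fun γ => by ring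
  rw [Finset.sum_congr rfl fun γ _ => h1 γ, ← Finset.mul_sum, B.sum_D_mul_D_of_ne hR, mul_zero]

theorem cosetMap_zUn_eq_zero {t : n.Partition × n.Partition × n.Partition}
    (h : kronecker t.1 t.2.1 t.2.2 = 0) : cosetMap n (zUn t.1 t.2.1 t.2.2) = 0 := by
  obtain ⟨B⟩ := nonempty_orthogonalBases n
  obtain ⟨cg⟩ := nonempty_clebschGordan B
  rw [cg.kronecker_eq_mult, Nat.cast_eq_zero] at h
  obtain ⟨c, hc, hz⟩ := exists_zUn_eq_smul B t
  have key : ∀ a b, unit₃ B t a a * diagAverage n * unit₃ B t b b = 0 := by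
    intro a b
    have h1 : ∀ γ, unit₃ B t a a * diag₃ γ * unit₃ B t b b =
        ((tensorRep B t.1 t.2.1 γ (a.1, a.2.1) (b.1, b.2.1) * B.D t.2.2 γ a.2.2 b.2.2 : ℝ) : ℂ) •
          unit₃ B t a b := fun γ => by
      simp only [unit₃, diag₃, Algebra.TensorProduct.tmul_mul_tmul, unit_mul_el_mul_unit,
        TensorProduct.smul_tmul_smul, tensorRep_apply]
      push_cast
      rfl
    rw [diagAverage, mul_smul_comm, smul_mul_assoc, Finset.mul_sum, Finset.sum_mul]
    simp only [h1]
    rw [← Finset.sum_smul, ← Complex.ofReal_sum, sum_tensorRep_mul_D cg h, Complex.ofReal_zero,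
      zero_smul, smul_zero]
  -- With p the central idempotent of the block, p e = p p e = p e p; expanding both copies of p in
  -- diagonal matrix units reduces the claim to `key`.
  rw [cosetMap_zUn, hz, smul_mul_assoc, ← idem₃_mul_self, mul_assoc, ← idem₃_mul_comm,
    idem₃_eq_sum, Finset.sum_mul, Finset.sum_mul, Finset.sum_eq_zero, smul_zero]
  intro a _
  rw [Finset.mul_sum, Finset.sum_eq_zero]
  exact fun b _ => key a b

/-- The classes with nonzero Kronecker coefficient still span, as the others vanish, and pairing
with the P_un separates them. -/
theorem finrank_centreKun : Module.finrank ℂ (centreKun n) = numNonvanishing n := by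
  obtain ⟨B⟩ := nonempty_orthogonalBases n
  obtain ⟨cg⟩ := nonempty_clebschGordan B
  classical
  let T := {t : n.Partition × n.Partition × n.Partition // kronecker t.1 t.2.1 t.2.2 ≠ 0}
  let v : T → A₃ n := fun t => cosetMap n (zUn t.1.1 t.1.2.1 t.1.2.2)
  have hli : LinearIndependent ℂ v := by
    rw [Fintype.linearIndependent_iff]
    intro a ha s
    have h1 := congrArg (fun x => pairing₃ n x (Pun cg s.1.1 s.1.2.1 s.1.2.2)) ha
    simp only [map_sum, map_smul, LinearMap.sum_apply, LinearMap.smul_apply, map_zero,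
      LinearMap.zero_apply, v, pairing₃_cosetMap_zUn_Pun] at h1
    rw [Finset.sum_eq_single s] at h1
    · simp only [and_self, if_true, smul_eq_mul, mul_eq_zero, Complex.ofReal_eq_zero, s.2,
        dim_ne_zero_complex, or_false] at h1
      exact h1
    · intro t _ hts
      rw [if_neg, smul_zero]
      rintro ⟨h2, h3, h4⟩
      exact hts (Subtype.ext (Prod.ext h2.symm (Prod.ext h3.symm h4.symm)))
    · simp
  have hspan : Submodule.span ℂ (Set.range v) = centreKun n := by
    rw [← span_cosetMap_zUn]
    refine le_antisymm (Submodule.span_mono ?_) (Submodule.span_le.2 ?_)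
    · rintro _ ⟨t, rfl⟩
      exact ⟨t.1, rfl⟩
    · rintro _ ⟨t, rfl⟩
      by_cases h : kronecker t.1 t.2.1 t.2.2 = 0
      · simp only [cosetMap_zUn_eq_zero h]
        exact Submodule.zero_mem _
      · exact Submodule.subset_span ⟨⟨t, h⟩, rfl⟩
  rw [← hspan, finrank_span_eq_card hli, numNonvanishing, Nat.card_eq_fintype_card]

end DoubleCoset

/-! ### Transfer to the centralizer algebra -/

section Centralizer

variable {n : ℕ}

/-- The diagonal element `γ ⊗ γ`. -/
noncomputable def diag₂ (γ : S n) : A₂ n := el γ ⊗ₜ[ℂ] el γ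

theorem diag₂_mul_diag₂ (σ τ : S n) : diag₂ σ * diag₂ τ = diag₂ (σ * τ) := by
  simp only [diag₂, Algebra.TensorProduct.tmul_mul_tmul, el_mul_el]

theorem diag₂_one : diag₂ (1 : S n) = 1 := rfl

theorem diag₃_eq (γ : S n) : diag₃ γ = diag₂ γ ⊗ₜ[ℂ] el γ := rfl

theorem mem_K {x : A₂ n} : x ∈ K n ↔ ∀ γ : S n, diag₂ γ * x = x * diag₂ γ := by
  rw [K, Subalgebra.mem_centralizer_iff]
  exact Set.forall_mem_range

theorem mem_centreK {x : A₂ n} : x ∈ centreK n ↔ x ∈ K n ∧ ∀ y ∈ K n, x * y = y * x := by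
  constructor
  · rintro ⟨⟨x, hx⟩, h, rfl⟩
    refine ⟨hx, fun y hy => ?_⟩
    exact (congrArg Subtype.val ((Subalgebra.mem_center_iff (R := ℂ)).1 h ⟨y, hy⟩)).symm
  · rintro ⟨hx, h⟩
    exact ⟨⟨x, hx⟩, (Subalgebra.mem_center_iff (R := ℂ)).2 fun y => Subtype.ext (h y y.2).symm, rfl⟩

/-- The map `x ↦ (x ⊗ 1) e`, with `e` the average of the diagonal permutations. It identifies
`𝒦(n)` with `𝒦_un(n)`. -/
noncomputable def toDoubleCoset (n : ℕ) : A₂ n →ₗ[ℂ] A₃ n :=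
  LinearMap.mulRight ℂ (diagAverage n) ∘ₗ (TensorProduct.mk ℂ (A₂ n) (A n)).flip 1

theorem toDoubleCoset_apply (x : A₂ n) : toDoubleCoset n x = (x ⊗ₜ[ℂ] 1) * diagAverage n := rfl

/-- The coefficient of the identity in the third tensor factor of (x ⊗ 1) e is x/n!, since only γ =
1 contributes there. -/
theorem toDoubleCoset_injective : Function.Injective (toDoubleCoset n) := by
  let ψ : A₃ n →ₗ[ℂ] A₂ n := (TensorProduct.rid ℂ (A₂ n)).toLinearMap ∘ₗ
    TensorProduct.map LinearMap.id (coeff 1)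
  have h : ∀ x, ψ (toDoubleCoset n x) = (n.factorial : ℂ)⁻¹ • x := by
    intro x
    rw [toDoubleCoset_apply, diagAverage, mul_smul_comm, Finset.mul_sum, map_smul, map_sum]
    congr 1
    rw [Finset.sum_eq_single 1]
    · simp [ψ, diag₃_eq, coeff_el, diag₂_one]
    · intro γ _ hγ
      simp [ψ, diag₃_eq, coeff_el, hγ]
    · simp
  intro x y hxy
  have h1 := congrArg ψ hxy
  rw [h, h] at h1
  exact smul_right_injective _ (inv_ne_zero (factorial_ne_zero_complex n)) h1

/-- Moving γ ⊗ γ ⊗ γ past x ⊗ 1 conjugates x, and e then absorbs it. Left invariance of the image is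
therefore conjugation invariance of x. -/
theorem diag₃_mul_toDoubleCoset (γ : S n) (x : A₂ n) :
    diag₃ γ * toDoubleCoset n x = toDoubleCoset n (diag₂ γ * x * diag₂ γ⁻¹) := by
  have h1 : diag₃ γ * (x ⊗ₜ[ℂ] 1) = ((diag₂ γ * x * diag₂ γ⁻¹) ⊗ₜ[ℂ] 1) * diag₃ γ := by
    rw [diag₃_eq, Algebra.TensorProduct.tmul_mul_tmul, Algebra.TensorProduct.tmul_mul_tmul,
      mul_assoc _ _ (diag₂ γ), diag₂_mul_diag₂, inv_mul_cancel, diag₂_one, mul_one, mul_one, one_mul]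
  rw [toDoubleCoset_apply, ← mul_assoc, h1, mul_assoc, diag₃_mul_diagAverage, toDoubleCoset_apply]

theorem mem_K_iff_conj {x : A₂ n} : x ∈ K n ↔ ∀ γ : S n, diag₂ γ * x * diag₂ γ⁻¹ = x := by
  rw [mem_K]
  refine forall_congr' fun γ => ⟨fun h => ?_, fun h => ?_⟩
  · rw [h, mul_assoc, diag₂_mul_diag₂, mul_inv_cancel, diag₂_one, mul_one]
  · conv_rhs => rw [← h]
    rw [mul_assoc _ _ (diag₂ γ), diag₂_mul_diag₂, inv_mul_cancel, diag₂_one, mul_one]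

theorem toDoubleCoset_mem_Kun {x : A₂ n} : toDoubleCoset n x ∈ Kun n ↔ x ∈ K n := by
  rw [mem_K_iff_conj]
  constructor
  · intro h γ
    apply toDoubleCoset_injective
    rw [← diag₃_mul_toDoubleCoset]
    exact (h γ).1
  · intro h γ
    rw [diag₃_mul_toDoubleCoset, h]
    refine ⟨rfl, ?_⟩
    rw [toDoubleCoset_apply, mul_assoc, diagAverage_mul_diag₃]

theorem toDoubleCoset_mul_toDoubleCoset (x y : A₂ n) (hy : y ∈ K n) :
    toDoubleCoset n x * toDoubleCoset n y = toDoubleCoset n (x * y) := by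
  have h1 : diagAverage n * toDoubleCoset n y = toDoubleCoset n y :=
    (mem_Kun.1 (toDoubleCoset_mem_Kun.2 hy)).1
  rw [toDoubleCoset_apply x, mul_assoc, h1, toDoubleCoset_apply, ← mul_assoc,
    Algebra.TensorProduct.tmul_mul_tmul, mul_one, toDoubleCoset_apply]

theorem tmul_el_mul_diagAverage (x : A₂ n) (σ : S n) :
    (x ⊗ₜ[ℂ] el σ) * diagAverage n = toDoubleCoset n (x * diag₂ σ⁻¹) := by
  have h1 : x ⊗ₜ[ℂ] el σ = ((x * diag₂ σ⁻¹) ⊗ₜ[ℂ] 1) * diag₃ σ := by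
    rw [diag₃_eq, Algebra.TensorProduct.tmul_mul_tmul, mul_assoc, diag₂_mul_diag₂, inv_mul_cancel,
      diag₂_one, mul_one, one_mul]
  rw [h1, mul_assoc, diag₃_mul_diagAverage, toDoubleCoset_apply]

/-- A permutation σ in the third factor can be traded for σ⁻¹ ⊗ σ⁻¹ on the first two, because e
absorbs diagonal elements. -/
theorem mul_diagAverage_mem_range_toDoubleCoset (y : A₃ n) :
    y * diagAverage n ∈ LinearMap.range (toDoubleCoset n) := by
  induction y using TensorProduct.induction_on with
  | zero => rw [zero_mul]; exact Submodule.zero_mem _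
  | add x y hx hy => rw [add_mul]; exact Submodule.add_mem _ hx hy
  | tmul x w =>
    have h : w ∈ Submodule.span ℂ (Set.range (el : S n → A n)) := span_el ▸ Submodule.mem_top
    induction h using Submodule.span_induction with
    | mem w hw =>
      obtain ⟨σ, rfl⟩ := hw
      exact ⟨_, (tmul_el_mul_diagAverage x σ).symm⟩
    | zero => rw [TensorProduct.tmul_zero, zero_mul]; exact Submodule.zero_mem _
    | add u v _ _ hu hv =>
      rw [TensorProduct.tmul_add, add_mul]
      exact Submodule.add_mem _ hu hv
    | smul c u _ hu =>
      rw [TensorProduct.tmul_smul, smul_mul_assoc]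
      exact Submodule.smul_mem _ _ hu

theorem exists_toDoubleCoset_eq {y : A₃ n} (hy : y ∈ Kun n) :
    ∃ x ∈ K n, toDoubleCoset n x = y := by
  obtain ⟨x, hx⟩ := mul_diagAverage_mem_range_toDoubleCoset y
  rw [(mem_Kun.1 hy).2] at hx
  exact ⟨x, toDoubleCoset_mem_Kun.1 (hx ▸ hy), hx⟩

theorem map_centreK : (centreK n).map (toDoubleCoset n) = centreKun n := by
  ext y
  rw [Submodule.mem_map]
  constructor
  · rintro ⟨x, hx, rfl⟩
    rw [mem_centreK] at hx
    refine mem_centreKun.2 ⟨toDoubleCoset_mem_Kun.2 hx.1, fun y hy => ?_⟩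
    obtain ⟨w, hw, rfl⟩ := exists_toDoubleCoset_eq hy
    rw [toDoubleCoset_mul_toDoubleCoset _ _ hw, toDoubleCoset_mul_toDoubleCoset _ _ hx.1,
      hx.2 w hw]
  · intro hy
    rw [mem_centreKun] at hy
    obtain ⟨x, hx, rfl⟩ := exists_toDoubleCoset_eq hy.1
    refine ⟨x, mem_centreK.2 ⟨hx, fun w hw => toDoubleCoset_injective ?_⟩, rfl⟩
    rw [← toDoubleCoset_mul_toDoubleCoset _ _ hw, ← toDoubleCoset_mul_toDoubleCoset _ _ hx,
      hy.2 _ (toDoubleCoset_mem_Kun.2 hw)]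

/-- In z_{R₁} ⊗ z_{R₂} ⊗ z_{R₃} each σ of the third factor is traded for σ⁻¹ ⊗ σ⁻¹ on the first two;
the inverse is harmless because χ(σ⁻¹) = χ(σ). -/
theorem toDoubleCoset_zTriple (R₁ R₂ R₃ : n.Partition) :
    toDoubleCoset n (zTriple R₁ R₂ R₃) = cosetMap n (zUn R₁ R₂ R₃) := by
  have h1 : zTriple R₁ R₂ R₃ =
      ∑ σ : S n, (chi R₃ σ : ℂ) • ((z R₁ ⊗ₜ[ℂ] z R₂) * diag₂ σ⁻¹) := by
    rw [zTriple, Finset.mul_sum]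
    refine Fintype.sum_equiv (Equiv.inv _) _ _ fun σ => ?_
    rw [Equiv.inv_apply, inv_inv, chi_inv, mul_smul_comm, diag₂]
  rw [cosetMap_zUn, zUn, z.eq_1 R₃, h1, map_sum, TensorProduct.tmul_sum, Finset.sum_mul]
  refine Finset.sum_congr rfl fun σ _ => ?_
  rw [map_smul, TensorProduct.tmul_smul, smul_mul_assoc, tmul_el_mul_diagAverage]

theorem zTriple_mem_centreK (R₁ R₂ R₃ : n.Partition) : zTriple R₁ R₂ R₃ ∈ centreK n := by
  have h := cosetMap_zUn_mem_centreKun R₁ R₂ R₃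
  rw [← toDoubleCoset_zTriple, ← map_centreK] at h
  obtain ⟨x, hx, h⟩ := h
  exact toDoubleCoset_injective h ▸ hx

theorem span_zTriple :
    Submodule.span ℂ (Set.range fun t : n.Partition × n.Partition × n.Partition =>
      zTriple t.1 t.2.1 t.2.2) = centreK n := by
  apply Submodule.map_injective_of_injective toDoubleCoset_injective
  rw [map_centreK, ← span_cosetMap_zUn, Submodule.map_span, ← Set.range_comp]
  congr 2
  funext t
  exact toDoubleCoset_zTriple _ _ _

theorem finrank_centreK : Module.finrank ℂ (centreK n) = numNonvanishing n := by
  rw [← finrank_centreKun, ← map_centreK]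
  exact (Submodule.equivMapOfInjective _ toDoubleCoset_injective _).finrank_eq

end Centralizer

/-! ### Vanishing Kronecker coefficients and overcompleteness -/

section Overcomplete

variable {n : ℕ}

theorem rowOf_indiscrete (i : Fin n) : rowOf (Nat.Partition.indiscrete n) i = 0 := by
  have hn : n ≠ 0 := by rintro rfl; exact i.elim0
  have h := rowOf_colOf_mem (Nat.Partition.indiscrete n) i
  rw [diagram, YoungDiagram.mem_ofRowLens] at h
  obtain ⟨h1, -⟩ := h
  rw [Multiset.length_sort, Nat.Partition.indiscrete_parts hn, Multiset.card_singleton] at h1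
  omega

/-- All letters stand in one row, so every permutation is absorbed by the row sum and acts
trivially. That the dimension is 1 is not needed: a constant character suffices below. -/
theorem chi_indiscrete (σ : S n) :
    chi (Nat.Partition.indiscrete n) σ = dim (Nat.Partition.indiscrete n) := by
  have h0 : ∀ σ : S n, PreservesRows (Nat.Partition.indiscrete n) σ := fun σ i => by
    rw [rowOf_indiscrete, rowOf_indiscrete]
  have h1 : ∀ (σ : S n) (x : MonoidAlgebra ℝ (S n)), MonoidAlgebra.single σ 1 * x *
      youngSymmetrizer (Nat.Partition.indiscrete n) =
        x * youngSymmetrizer (Nat.Partition.indiscrete n) := by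
    intro σ x
    induction x using induction_single with
    | h1 g =>
      rw [MonoidAlgebra.single_mul_single, one_mul, youngSymmetrizer_eq, ← mul_assoc, ← mul_assoc,
        single_mul_rowSum (h0 _), single_mul_rowSum (h0 _)]
    | h2 x y hx hy => rw [mul_add, add_mul, hx, hy, add_mul]
    | h3 c x hx => rw [mul_smul_comm, smul_mul_assoc, hx, smul_mul_assoc]
  have h2 : spechtRep (Nat.Partition.indiscrete n) σ = 1 := by
    ext1 v
    obtain ⟨x, rfl⟩ := exists_smul_spechtGen v
    refine Subtype.ext ?_
    change MonoidAlgebra.single σ 1 * (x * youngSymmetrizer _) = x * youngSymmetrizer _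
    rw [← mul_assoc, h1]
  rw [chi, h2, ← map_one (spechtRep (Nat.Partition.indiscrete n))]
  exact chi_one _

/-- With a constant third character, the Kronecker coefficient reduces to the orthogonality of χ^R
and χ^{R'}. -/
theorem kronecker_indiscrete_eq_zero {R R' : n.Partition} (h : R ≠ R') :
    kronecker R R' (Nat.Partition.indiscrete n) = 0 := by
  simp only [kronecker, chi_indiscrete, ← Finset.sum_mul, OrthogonalBases.sum_chi_mul_chi, if_neg h,
    zero_mul, mul_zero]

theorem exists_partition_ne (hn : 2 ≤ n) : ∃ R R' : n.Partition, R ≠ R' := by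
  refine ⟨Nat.Partition.indiscrete n, ⟨Multiset.replicate n 1, fun h => ?_, by simp⟩, fun h => ?_⟩
  · rw [Multiset.eq_of_mem_replicate h]
    exact one_pos
  · have h1 := congrArg (fun R : n.Partition => R.parts.card) h
    simp only [Nat.Partition.indiscrete_parts (by omega : n ≠ 0), Multiset.card_singleton,
      Multiset.card_replicate] at h1
    omega

theorem numNonvanishing_lt (hn : 2 ≤ n) : numNonvanishing n < Fintype.card n.Partition ^ 3 := by
  classical
  obtain ⟨R, R', h⟩ := exists_partition_ne hn
  have h1 : Fintype.card n.Partition ^ 3 =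
      Fintype.card (n.Partition × n.Partition × n.Partition) := by
    rw [Fintype.card_prod, Fintype.card_prod, pow_three]
  rw [numNonvanishing, Nat.card_eq_fintype_card, h1]
  exact Fintype.card_subtype_lt (x := (R, R', Nat.Partition.indiscrete n))
    (not_not.2 (kronecker_indiscrete_eq_zero h))

theorem not_linearIndependent_of_span_eq {M : Type*} [AddCommGroup M] [Module ℂ M]
    {v : n.Partition × n.Partition × n.Partition → M} {W : Submodule ℂ M} (hn : 2 ≤ n)
    (hspan : Submodule.span ℂ (Set.range v) = W) (hW : Module.finrank ℂ W = numNonvanishing n) :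
    ¬ LinearIndependent ℂ v := by
  intro hv
  have h1 := numNonvanishing_lt hn
  rw [← hW, ← hspan, finrank_span_eq_card hv, Fintype.card_prod, Fintype.card_prod,
    pow_three] at h1
  exact lt_irrefl _ h1

end Overcomplete

end KroneckerAlgebra

theorem mainTheorem6 (n : ℕ) :
    -- orthogonal forms of the irreps and Clebsch-Gordan coefficients exist
    (Nonempty (KroneckerAlgebra.OrthogonalBases n) ∧
      ∀ B : KroneckerAlgebra.OrthogonalBases n, Nonempty (KroneckerAlgebra.ClebschGordan B)) ∧
    -- centralizer description: membership, spanning, pairing, overcompleteness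
    ((∀ R₁ R₂ R₃ : n.Partition,
        KroneckerAlgebra.zTriple R₁ R₂ R₃ ∈ KroneckerAlgebra.centreK n) ∧
      Submodule.span ℂ (Set.range fun t : n.Partition × n.Partition × n.Partition =>
        KroneckerAlgebra.zTriple t.1 t.2.1 t.2.2) = KroneckerAlgebra.centreK n ∧
      (∀ (B : KroneckerAlgebra.OrthogonalBases n) (cg : KroneckerAlgebra.ClebschGordan B)
        (R₁ R₂ R₃ R₁' R₂' R₃' : n.Partition),
        KroneckerAlgebra.pairing₂ n (KroneckerAlgebra.P cg R₁ R₂ R₃)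
            (KroneckerAlgebra.zTriple R₁' R₂' R₃') =
          if R₁ = R₁' ∧ R₂ = R₂' ∧ R₃ = R₃' then
            (n.factorial : ℂ) * (KroneckerAlgebra.kronecker R₁ R₂ R₃ : ℂ) else 0) ∧
      Module.finrank ℂ (KroneckerAlgebra.centreK n) = KroneckerAlgebra.numNonvanishing n ∧
      (2 ≤ n → ¬ LinearIndependent ℂ fun t : n.Partition × n.Partition × n.Partition =>
        KroneckerAlgebra.zTriple t.1 t.2.1 t.2.2)) ∧
    -- double coset description: the same
    ((∀ R₁ R₂ R₃ : n.Partition,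
        KroneckerAlgebra.zUn R₁ R₂ R₃ ∈ Subalgebra.center ℂ (KroneckerAlgebra.A₃ n) ∧
        KroneckerAlgebra.cosetMap n (KroneckerAlgebra.zUn R₁ R₂ R₃) ∈
          KroneckerAlgebra.centreKun n) ∧
      Submodule.span ℂ (Set.range fun t : n.Partition × n.Partition × n.Partition =>
        KroneckerAlgebra.cosetMap n (KroneckerAlgebra.zUn t.1 t.2.1 t.2.2)) =
          KroneckerAlgebra.centreKun n ∧
      (∀ (B : KroneckerAlgebra.OrthogonalBases n) (cg : KroneckerAlgebra.ClebschGordan B)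
        (R₁ R₂ R₃ R₁' R₂' R₃' : n.Partition),
        KroneckerAlgebra.pairing₃ n (KroneckerAlgebra.zUn R₁' R₂' R₃')
            (KroneckerAlgebra.Pun cg R₁ R₂ R₃) =
          (if R₁ = R₁' ∧ R₂ = R₂' ∧ R₃ = R₃' then
            (KroneckerAlgebra.dim R₃ : ℂ) * (KroneckerAlgebra.kronecker R₁ R₂ R₃ : ℂ) else 0) ∧
        KroneckerAlgebra.pairing₃ n
            (KroneckerAlgebra.cosetMap n (KroneckerAlgebra.zUn R₁' R₂' R₃'))
            (KroneckerAlgebra.Pun cg R₁ R₂ R₃) =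
          (if R₁ = R₁' ∧ R₂ = R₂' ∧ R₃ = R₃' then
            (KroneckerAlgebra.dim R₃ : ℂ) * (KroneckerAlgebra.kronecker R₁ R₂ R₃ : ℂ) else 0)) ∧
      Module.finrank ℂ (KroneckerAlgebra.centreKun n) = KroneckerAlgebra.numNonvanishing n ∧
      (2 ≤ n → ¬ LinearIndependent ℂ fun t : n.Partition × n.Partition × n.Partition =>
        KroneckerAlgebra.cosetMap n (KroneckerAlgebra.zUn t.1 t.2.1 t.2.2))) ∧
    -- the number of labels exceeds the dimension of the centre
    (2 ≤ n → KroneckerAlgebra.numNonvanishing n < Fintype.card n.Partition ^ 3) := by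
  refine ⟨⟨KroneckerAlgebra.nonempty_orthogonalBases n, KroneckerAlgebra.nonempty_clebschGordan⟩,
    ⟨KroneckerAlgebra.zTriple_mem_centreK, KroneckerAlgebra.span_zTriple,
      fun _ cg => KroneckerAlgebra.pairing₂_P_zTriple cg, KroneckerAlgebra.finrank_centreK,
      fun hn => KroneckerAlgebra.not_linearIndependent_of_span_eq hn
        KroneckerAlgebra.span_zTriple KroneckerAlgebra.finrank_centreK⟩,
    ⟨fun R₁ R₂ R₃ => ⟨Subalgebra.mem_center_iff.2 fun x =>
        (KroneckerAlgebra.zUn_mul_comm R₁ R₂ R₃ x).symm,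
        KroneckerAlgebra.cosetMap_zUn_mem_centreKun R₁ R₂ R₃⟩,
      KroneckerAlgebra.span_cosetMap_zUn, fun _ cg R₁ R₂ R₃ R₁' R₂' R₃' => ⟨?_,
        KroneckerAlgebra.pairing₃_cosetMap_zUn_Pun cg R₁ R₂ R₃ R₁' R₂' R₃'⟩,
      KroneckerAlgebra.finrank_centreKun,
      fun hn => KroneckerAlgebra.not_linearIndependent_of_span_eq hn
        KroneckerAlgebra.span_cosetMap_zUn KroneckerAlgebra.finrank_centreKun⟩,
    KroneckerAlgebra.numNonvanishing_lt⟩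
  -- The pairing with z_un itself is the case γ = 1.
  have h1 := KroneckerAlgebra.pairing₃_zUn_mul_diag₃_Pun cg R₁ R₂ R₃ R₁' R₂' R₃' 1
  have h2 : KroneckerAlgebra.diag₃ (1 : KroneckerAlgebra.S n) = 1 := rfl
  rw [h2, mul_one] at h1
  exact h1
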